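/- **Theorem (Rounding).** For a real matrix $M$ of dimension $N$ let $\|M\|$ be its spectral norm. The *renormalized MaxQP SDP* for $M$ is to maximize $\mathrm{tr}(\tfrac{1}{\|M\|}MX)$ over psd matrices $X$ with $\mathrm{tr}(X)=1$ and $X_{ii}=\tfrac1N$ for all $i$. A psd matrix $\rho$ with $\mathrm{tr}(\rho)=1$ is an *approximately feasible, approximately optimal solution with accuracy $\delta$* if $\sum_i|\rho_{ii}-\tfrac1N|\le\delta$ and $\mathrm{tr}(\tfrac1{\|M\|}M\rho)\ge\mathrm{tr}(\tfrac1{\|M\|}MX)-\delta$ for every feasible $X$. Let $A$ be a real $n\times n$ matrix ($n\ge1$), $A'=\begin{pmatrix}0&A\\A^T&0\end{pmatrix}$, $\|A\|_{\infty\to1}=\max_{x,y\in\{\pm1\}^n}\langle x,Ay\rangle$, and let $\gamma=\tfrac2\pi$ if $A$ is positive semidefinite and $\gamma=\tfrac4\pi-1$ otherwise. Let $\epsilon>0$, $0<\eta\le\epsilon$, $s\ge1$, $K>0$, and let $H^\sharp$ be a real symmetric $2n\times2n$ matrix such that * the Gibbs state $\rho^\sharp=e^{-H^\sharp}/\mathrm{tr}(e^{-H^\sharp})$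 is an approximately feasible, approximately optimal solution of the renormalized MaxQP SDP for $A'$ with accuracy $\epsilon^4$, with value $\alpha^\sharp=\mathrm{tr}(\tfrac1{\|A'\|}A'\rho^\sharp)$; * $\|H^\sharp\|\le K\log(2n)/\eta$; * each row of $H^\sharp$ has at most $s$ nonzero off-diagonal entries (for instance, $A'$ is $s$-sparse and $H^\sharp$ is a linear combination of $A'$ and a diagonal matrix). Then there are constants $c,C>0$ that depend only on $K$ such that the following holds for $l=\lceil c\log(2n)/\eta\rceil$. Draw $g\in\mathbb R^{2n}$ with i.i.d. standard normal entries, compute $z=\sum_{k=0}^{l}\frac{(-H^\sharp)^k}{2^kk!}g$, and let $(x,y)\in\{\pm1\}^n\times\{\pm1\}^n$ be the signs of the entries of $z$ (with $\mathrm{sign}(0)=1$). A single program for the real RAM (unit cost arithmetic, unit cost draws of standard normal numbers, unit cost adjacency list queries to $H^\sharp$), which receives $n$ and $l$ as inputs, computes $(x,y)$ in at most $C\,ns\,(1+\log(2n)/\eta)$ steps, that is, in time $\tilde{\mathcal O}(ns)$ if $1/\eta$ is polynomial in $1/\epsilon$. Moreover, $$\gamma\left(\|A\|_{\infty\to1}-C\,n\|A\|\epsilon\right)\le\mathbb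 E\left[\langle x,Ay\rangle\right]\le\|A\|_{\infty\to1}$$ and $$\gamma\,n\|A\|\left(\alpha^\sharp-C\epsilon\right)\le\mathbb E\left[\langle x,Ay\rangle\right]\le n\|A\|\left(\alpha^\sharp+C\epsilon\right).$$ -/

import Mathlib

open MeasureTheory ProbabilityTheory
open scoped Matrix

/-! ### Gibbs states and the truncated Taylor rounding map -/

/-- The Gibbs state `exp (-H) / tr (exp (-H))` of the Hamiltonian `H`. -/
noncomputable def gibbsState {ι : Type*} [Fintype ι] [DecidableEq ι] (H : Matrix ι ι ℝ) :
    Matrix ι ι ℝ :=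
  (NormedSpace.exp (-H)).trace⁻¹ • NormedSpace.exp (-H)

/-- The truncated Taylor series `∑_{k ≤ l} (-H)^k / (2^k k!)` of `exp (-H / 2)`. -/
noncomputable def taylorHalf {ι : Type*} [Fintype ι] [DecidableEq ι] (H : Matrix ι ι ℝ) (l : ℕ) :
    Matrix ι ι ℝ :=
  ∑ k ∈ Finset.range (l + 1), ((2 : ℝ) ^ k * (k.factorial : ℝ))⁻¹ • (-H) ^ k

/-- The sign of a real number, as an element of `{1, -1}` (the value at `0` is `1`). -/
noncomputable def signPM (t : ℝ) : ℝ := if 0 ≤ t then 1 else -1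

/-- The rounding map: the signs of the entries of `∑_{k ≤ l} (-H)^k / (2^k k!) g`. -/
noncomputable def roundSigns {ι : Type*} [Fintype ι] [DecidableEq ι] (H : Matrix ι ι ℝ) (l : ℕ)
    (g : ι → ℝ) (i : ι) : ℝ :=
  signPM ((taylorHalf H l *ᵥ g) i)

open scoped Matrix.Norms.L2Operator

/-! ### The `∞ → 1` norm and the renormalized MaxQP SDP

From here on, `‖M‖` for a real matrix `M` is the operator norm with respect to the Euclidean norm.
-/

/-- The matrix `A' = [[0, A], [Aᵀ, 0]]`. -/
def bipartiteMatrix {n : ℕ} (A : Matrix (Fin n) (Fin n) ℝ) :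
    Matrix (Fin n ⊕ Fin n) (Fin n ⊕ Fin n) ℝ :=
  Matrix.fromBlocks 0 A Aᵀ 0

/-- All entries of the vector are `1` or `-1`. -/
def IsSignVector {ι : Type*} (x : ι → ℝ) : Prop := ∀ i, x i = 1 ∨ x i = -1

/-- `‖A‖_{∞ → 1}`, the maximum of `⟨x, A y⟩` over sign vectors `x` and `y`. -/
noncomputable def inftyOneNorm {n : ℕ} (A : Matrix (Fin n) (Fin n) ℝ) : ℝ :=
  sSup {r : ℝ | ∃ x y : Fin n → ℝ, IsSignVector x ∧ IsSignVector y ∧ r = x ⬝ᵥ (A *ᵥ y)}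

/-- The objective function `tr (‖M‖⁻¹ M X)` of the renormalized MaxQP SDP for `M`. -/
noncomputable def sdpObjective {ι : Type*} [Fintype ι] [DecidableEq ι] (M X : Matrix ι ι ℝ) : ℝ :=
  ((‖M‖⁻¹ • M) * X).trace

/-- The feasible points of the renormalized MaxQP SDP: psd matrices of trace one whose diagonal
entries are all equal to `1 / N`, where `N` is the dimension. -/
def IsSDPFeasible {ι : Type*} [Fintype ι] [DecidableEq ι] (X : Matrix ι ι ℝ) : Prop :=
  X.PosSemidef ∧ X.trace = 1 ∧ ∀ i, X i i = 1 / (Fintype.card ι : ℝ)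

/-- `ρ` is an approximately feasible, approximately optimal solution of the renormalized MaxQP SDP
for `M` with accuracy `δ`: it is a state, its diagonal is within `δ` of the uniform distribution
in `ℓ¹`, and no feasible point has an objective value that exceeds the one of `ρ` by more than
`δ`. -/
def IsApproxSDPSolution {ι : Type*} [Fintype ι] [DecidableEq ι] (M : Matrix ι ι ℝ) (δ : ℝ)
    (ρ : Matrix ι ι ℝ) : Prop :=
  ρ.PosSemidef ∧ ρ.trace = 1 ∧ (∑ i, |ρ i i - 1 / (Fintype.card ι : ℝ)| ≤ δ) ∧
    ∀ X : Matrix ι ι ℝ, IsSDPFeasible X → sdpObjective M X ≤ sdpObjective M ρ + δ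

/-- Every row of `H` has at most `s` nonzero off-diagonal entries. If `M` has at most `s` nonzero
entries per row, then this holds for every matrix `a • M + D` with `D` diagonal. -/
def IsOffDiagSparse {ι : Type*} [Fintype ι] (s : ℕ) (H : Matrix ι ι ℝ) : Prop :=
  ∀ i, {j | j ≠ i ∧ H i j ≠ 0}.ncard ≤ s

open Classical in
/-- The rounding constant: `2 / π` for psd matrices and `4 / π - 1` for all others. -/
noncomputable def roundingConst {n : ℕ} (A : Matrix (Fin n) (Fin n) ℝ) : ℝ :=
  if A.PosSemidef then 2 / Real.pi else 4 / Real.pi - 1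

/-! ### A randomized real RAM with adjacency list access to a matrix

Programs work on natural number registers (used for indices and counters), real registers, and
arrays of reals with indirect addressing. Every instruction and every evaluation of a branching
condition costs one unit of time. Such an instruction can be a draw of a fresh standard normal
number, or one query to the adjacency list of the input matrix.
-/

/-- Adjacency list access to a matrix of dimension `dim`. -/
structure MatrixOracle where
  /-- The position of the `k`-th nonzero entry (from `k = 0` on) of row `i`;
  the answer is `dim` if there is none. -/
  pos : ℕ → ℕ → ℕ
  /-- The entry in row `i` and column `j`. -/
  entry : ℕ → ℕ → ℝ

/-- The adjacency list of `M`, with the nonzero entries of a row in increasing order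
of their columns. -/
noncomputable def adjacencyOracle {N : ℕ} (M : Matrix (Fin N) (Fin N) ℝ) : MatrixOracle where
  pos i k := if h : i < N then
      (((Finset.univ.filter fun j : Fin N => M ⟨i, h⟩ j ≠ 0).sort (· ≤ ·)).map Fin.val).getD k N
    else N
  entry i j := if h : i < N ∧ j < N then M ⟨i, h.1⟩ ⟨j, h.2⟩ else 0

/-- The state of the machine; `drawn` counts the random numbers that were drawn so far. -/
structure RAMState where
  nreg : ℕ → ℕ
  rreg : ℕ → ℝ
  mem : ℕ → ℕ → ℝ
  drawn : ℕ

/-- Elementary instructions. The first argument `d` is the target register, except for `store`. -/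
inductive RAMInstr where
  | nconst (d k : ℕ)
  | nadd (d a b : ℕ)
  | nsub (d a b : ℕ)
  | rofNat (d a : ℕ)
  | radd (d a b : ℕ)
  | rsub (d a b : ℕ)
  | rmul (d a b : ℕ)
  | rdiv (d a b : ℕ)
  | load (d arr i : ℕ)
  | store (arr i a : ℕ)
  | gauss (d : ℕ)
  | queryPos (d i k : ℕ)
  | queryEntry (d i j : ℕ)

/-- Write `v` into the natural number register `d`. -/
def RAMState.setN (σ : RAMState) (d v : ℕ) : RAMState :=
  { σ with nreg := Function.update σ.nreg d v }

/-- Write `v` into the real register `d`. -/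
def RAMState.setR (σ : RAMState) (d : ℕ) (v : ℝ) : RAMState :=
  { σ with rreg := Function.update σ.rreg d v }

/-- The effect of an instruction, given the oracle `O` and the sequence `ω` of random numbers. -/
noncomputable def RAMInstr.effect (O : MatrixOracle) (ω : ℕ → ℝ) (σ : RAMState) :
    RAMInstr → RAMState
  | nconst d k => σ.setN d k
  | nadd d a b => σ.setN d (σ.nreg a + σ.nreg b)
  | nsub d a b => σ.setN d (σ.nreg a - σ.nreg b)
  | rofNat d a => σ.setR d (σ.nreg a)
  | radd d a b => σ.setR d (σ.rreg a + σ.rreg b)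
  | rsub d a b => σ.setR d (σ.rreg a - σ.rreg b)
  | rmul d a b => σ.setR d (σ.rreg a * σ.rreg b)
  | rdiv d a b => σ.setR d (σ.rreg a / σ.rreg b)
  | load d arr i => σ.setR d (σ.mem arr (σ.nreg i))
  | store arr i a =>
      { σ with mem := Function.update σ.mem arr
                (Function.update (σ.mem arr) (σ.nreg i) (σ.rreg a)) }
  | gauss d => { σ.setR d (ω σ.drawn) with drawn := σ.drawn + 1 }
  | queryPos d i k => σ.setN d (O.pos (σ.nreg i) (σ.nreg k))
  | queryEntry d i j => σ.setR d (O.entry (σ.nreg i) (σ.nreg j))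

/-- Programs: instructions, sequential composition, branching on the sign of a real register, and
loops that run as long as one natural number register is smaller than another one. -/
inductive RAMProg where
  | instr (c : RAMInstr)
  | seq (p q : RAMProg)
  | ifNonneg (a : ℕ) (p q : RAMProg)
  | whileLt (a b : ℕ) (p : RAMProg)

/-- `RAMExec O ω p σ t τ`: started in the state `σ`, the program `p` halts after exactly `t` units
of time, in the state `τ`. -/
inductive RAMExec (O : MatrixOracle) (ω : ℕ → ℝ) :
    RAMProg → RAMState → ℕ → RAMState → Prop where
  | instr (c : RAMInstr) (σ : RAMState) : RAMExec O ω (.instr c) σ 1 (c.effect O ω σ)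
  | seq {p q : RAMProg} {σ τ υ : RAMState} {t u : ℕ} (hp : RAMExec O ω p σ t τ)
      (hq : RAMExec O ω q τ u υ) : RAMExec O ω (.seq p q) σ (t + u) υ
  | ifPos {a : ℕ} {p : RAMProg} (q : RAMProg) {σ τ : RAMState} {t : ℕ} (h : 0 ≤ σ.rreg a)
      (hp : RAMExec O ω p σ t τ) : RAMExec O ω (.ifNonneg a p q) σ (t + 1) τ
  | ifNeg {a : ℕ} (p : RAMProg) {q : RAMProg} {σ τ : RAMState} {t : ℕ} (h : σ.rreg a < 0)
      (hq : RAMExec O ω q σ t τ) : RAMExec O ω (.ifNonneg a p q) σ (t + 1) τ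
  | whileDone {a b : ℕ} (p : RAMProg) {σ : RAMState} (h : σ.nreg b ≤ σ.nreg a) :
      RAMExec O ω (.whileLt a b p) σ 1 σ
  | whileStep {a b : ℕ} {p : RAMProg} {σ τ υ : RAMState} {t u : ℕ} (h : σ.nreg a < σ.nreg b)
      (hp : RAMExec O ω p σ t τ) (hw : RAMExec O ω (.whileLt a b p) τ u υ) :
      RAMExec O ω (.whileLt a b p) σ (t + u + 1) υ

/-- The machine is deterministic for a fixed sequence of random numbers. -/
theorem RAMExec.deterministic {O : MatrixOracle} {ω : ℕ → ℝ} {p : RAMProg} {σ τ : RAMState} {t : ℕ}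
    (h : RAMExec O ω p σ t τ) :
    ∀ {t' : ℕ} {τ' : RAMState}, RAMExec O ω p σ t' τ' → t = t' ∧ τ = τ' := by
  induction h with
  | instr c σ => intro t' τ' h'; cases h'; exact ⟨rfl, rfl⟩
  | seq _ _ ih₁ ih₂ =>
    intro t' τ' h'
    cases h' with
    | seq a b => obtain ⟨rfl, rfl⟩ := ih₁ a; obtain ⟨rfl, rfl⟩ := ih₂ b; exact ⟨rfl, rfl⟩
  | ifPos _ h _ ih =>
    intro t' τ' h'
    cases h' with
    | ifPos _ _ a => obtain ⟨rfl, rfl⟩ := ih a; exact ⟨rfl, rfl⟩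
    | ifNeg _ h2 _ => exact absurd h2 (not_lt.mpr h)
  | ifNeg _ h _ ih =>
    intro t' τ' h'
    cases h' with
    | ifPos _ h2 _ => exact absurd h (not_lt.mpr h2)
    | ifNeg _ _ a => obtain ⟨rfl, rfl⟩ := ih a; exact ⟨rfl, rfl⟩
  | whileDone _ h =>
    intro t' τ' h'
    cases h' with
    | whileDone _ _ => exact ⟨rfl, rfl⟩
    | whileStep h2 _ _ => exact absurd h2 (not_lt.mpr h)
  | whileStep h _ _ ih₁ ih₂ =>
    intro t' τ' h'
    cases h' with
    | whileDone _ h2 => exact absurd h (not_lt.mpr h2)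
    | whileStep _ a b => obtain ⟨rfl, rfl⟩ := ih₁ a; obtain ⟨rfl, rfl⟩ := ih₂ b; exact ⟨rfl, rfl⟩

/-- The initial state: the inputs `n` and `l` are in the natural number registers `0` and `1`, and
everything else is zero. -/
def RAMState.init (n l : ℕ) : RAMState where
  nreg := fun i => if i = 0 then n else if i = 1 then l else 0
  rreg := fun _ => 0
  mem := fun _ _ => 0
  drawn := 0

/-- The adjacency list of a matrix with rows and columns indexed by `Fin n ⊕ Fin n`: the first
summand has the indices `0, …, n - 1`, the second one has the indices `n, …, 2 n - 1`. -/
noncomputable def hamiltonianOracle {n : ℕ} (H : Matrix (Fin n ⊕ Fin n) (Fin n ⊕ Fin n) ℝ) :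
    MatrixOracle :=
  adjacencyOracle (H.reindex finSumFinEquiv finSumFinEquiv)

/-- The law of a sequence of independent standard normal random numbers. -/
noncomputable def gaussianSequence : Measure (ℕ → ℝ) :=
  Measure.infinitePi fun _ : ℕ => gaussianReal 0 1

/-- The random vector `g` that is made of the first `2 n` random numbers of the sequence `ω`. -/
def gaussianVector (n : ℕ) (ω : ℕ → ℝ) (i : Fin n ⊕ Fin n) : ℝ := ω (finSumFinEquiv i).val

/-- The sign vector `x`: the first half of the output of the rounding procedure. -/
noncomputable def roundX {n : ℕ} (H : Matrix (Fin n ⊕ Fin n) (Fin n ⊕ Fin n) ℝ) (l : ℕ)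
    (ω : ℕ → ℝ) (i : Fin n) : ℝ :=
  roundSigns H l (gaussianVector n ω) (Sum.inl i)

/-- The sign vector `y`: the second half of the output of the rounding procedure. -/
noncomputable def roundY {n : ℕ} (H : Matrix (Fin n ⊕ Fin n) (Fin n ⊕ Fin n) ℝ) (l : ℕ)
    (ω : ℕ → ℝ) (i : Fin n) : ℝ :=
  roundSigns H l (gaussianVector n ω) (Sum.inr i)

/-! The signs of `taylorHalf H l *ᵥ g` depend only on the directions of the rows of the truncated
series. The procedure is therefore hyperplane rounding of the correlation matrix `G = U * Uᵀ`, where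
`U` has the normalized rows. It remains to show that `G` is nearly optimal for the SDP, and to
compare `G` with the correlation matrix `X` of the signs.

Near optimality: the truncated series is `exp (-H / 2)` multiplied from the left by a perturbation
of the identity of size `O(ε ^ 2)` (`norm_taylorHalf_mul_exp_sub_one_le`). Since the diagonal of the
Gibbs state is uniform up to `ε ^ 4` in `ℓ¹`, normalizing the rows costs little, and `U / √(2n)` is
within `O(ε ^ 2)` of `gibbsSqrt H` in Frobenius norm (`exists_unit_rows`). The objective value of
`G` then differs from that of the Gibbs state by `O(ε ^ 2)` (`abs_trace_mul_gram_sub_le`).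

General `A`: by Rietz' inequality (`signCorrelation_sub_posSemidef`), `X - (2 / π) G` is psd; its
diagonal is the constant `1 - 2 / π`. After a sign flip of the second half and rescaling it is
feasible, so its pairing with `A` is at least `-(1 - 2 / π)` times the optimum. This gives the
factor `4 / π - 1` (`entrywiseInner_sign_ge`).

Psd `A`: Rietz' inequality gives the factor `2 / π` on the two diagonal blocks. Passing to the
off-diagonal block requires a bound on `E ⟨x - y, A (x - y)⟩`. Optimal dual weights `w` with `A ≤
diagonal w` (`exists_dual_optimal`) bound it by `∑ w i * E (x i - y i) ^ 2`. Near optimality of `G`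
forces the two unit vectors with index `i` to be close in `w`-average, and close vectors have mostly
equal signs (`two_sub_signCorrelation_le`). This last step divides an `O(ε ^ 2)` loss by `ε`, which
explains the accuracy `ε ^ 4` of the SDP solution.

The upper bounds hold because sign vectors and their correlations are feasible. The running time
comes from the recursion that obtains each Taylor term from the previous one by a sparse
matrix-vector product (`runs_roundingProg`). -/

/-! ### Signs and the standard normal distribution -/

theorem signPM_mul_self_eq_one (t : ℝ) : signPM t * signPM t = 1 := by
  unfold signPM; split_ifs <;> norm_num

theorem signPM_mul_self_eq_abs (t : ℝ) : signPM t * t = |t| := by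
  unfold signPM; split_ifs with h
  · rw [abs_of_nonneg h, one_mul]
  · rw [abs_of_neg (not_le.mp h), neg_one_mul]

theorem abs_signPM (t : ℝ) : |signPM t| = 1 := by
  unfold signPM; split_ifs <;> norm_num

theorem signPM_eq_or (t : ℝ) : signPM t = 1 ∨ signPM t = -1 := by
  unfold signPM; split_ifs <;> simp

theorem signPM_mul_of_pos {c : ℝ} (hc : 0 < c) (t : ℝ) : signPM (c * t) = signPM t := by
  unfold signPM; simp only [mul_nonneg_iff_of_pos_left hc]

theorem measurable_signPM : Measurable signPM :=
  Measurable.ite measurableSet_Ici measurable_const measurable_const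

theorem integral_abs_gaussianReal : ∫ x, |x| ∂gaussianReal 0 1 = √(2 / Real.pi) := by
  rw [integral_gaussianReal_eq_integral_smul one_ne_zero]
  have h1 : ∫ x : ℝ, gaussianPDFReal 0 1 x • |x|
      = ∫ x : ℝ, (fun y => (√(2 * Real.pi))⁻¹ * (y * Real.exp (-(1/2) * y ^ 2))) |x| := by
    congr 1; ext x
    simp only [gaussianPDFReal, smul_eq_mul, NNReal.coe_one, mul_one, sub_zero, sq_abs]
    rw [show -x ^ 2 / 2 = -(1/2) * x ^ 2 by ring]; ring
  rw [h1, integral_comp_abs (f := fun y => (√(2 * Real.pi))⁻¹ * (y * Real.exp (-(1/2) * y ^ 2))),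
    integral_const_mul]
  have h2 : ∫ x in Set.Ioi (0:ℝ), x * Real.exp (-(1/2) * x ^ 2) = 1 := by
    have := integral_rpow_mul_exp_neg_mul_rpow (p := 2) (q := 1) (b := 1/2) (by norm_num)
      (by norm_num) (by norm_num)
    norm_num at this
    simpa using this
  rw [h2, Real.sqrt_div (by norm_num), Real.sqrt_mul (by norm_num)]
  have : √(2:ℝ) * √2 = 2 := Real.mul_self_sqrt (by norm_num)
  have h3 : (0:ℝ) < √2 := by positivity
  have h4 : (0:ℝ) < √Real.pi := Real.sqrt_pos.2 Real.pi_pos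
  field_simp
  nlinarith

/-- The density is at most `1 / 2`, and the interval has length `2 τ`. -/
theorem gaussianReal_abs_le (τ : ℝ) (hτ : 0 ≤ τ) :
    (gaussianReal 0 1).real {x | |x| ≤ τ} ≤ τ := by
  rw [measureReal_def, gaussianReal_apply_eq_integral _ one_ne_zero,
    ENNReal.toReal_ofReal (integral_nonneg fun x => gaussianPDFReal_nonneg _ _ _)]
  have hset : {x : ℝ | |x| ≤ τ} = Set.Icc (-τ) τ := by ext x; simp [abs_le]
  rw [hset]
  have hb : ∀ x : ℝ, gaussianPDFReal 0 1 x ≤ 1 / 2 := by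
    intro x
    simp only [gaussianPDFReal, NNReal.coe_one, mul_one]
    have h2 : (2:ℝ) ≤ √(2 * Real.pi) := by
      apply Real.le_sqrt_of_sq_le; nlinarith [Real.pi_gt_three]
    have h3 : Real.exp (-(x - 0) ^ 2 / 2) ≤ 1 := Real.exp_le_one_iff.2 (by nlinarith [sq_nonneg (x-0)])
    calc _ ≤ (√(2 * Real.pi))⁻¹ * 1 := by gcongr
      _ ≤ 1 / 2 := by rw [mul_one, one_div]; exact inv_anti₀ (by norm_num) h2
  calc ∫ x in Set.Icc (-τ) τ, gaussianPDFReal 0 1 x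
      ≤ ∫ x in Set.Icc (-τ) τ, (1 / 2 : ℝ) :=
        setIntegral_mono (integrable_gaussianPDFReal 0 1).integrableOn
          (integrable_const _) (fun x => hb x)
    _ = τ := by
        rw [setIntegral_const, measureReal_def, Real.volume_Icc,
          ENNReal.toReal_ofReal (by linarith), smul_eq_mul]; ring

/-! ### Linear forms in independent Gaussians -/

section
variable {Ω ι : Type*} [MeasurableSpace Ω] [Fintype ι] {P : Measure Ω} {g : ι → Ω → ℝ}

/-- The joint law of two linear combinations of independent Gaussians is Gaussian. -/
theorem hasGaussianLaw_linear_pair (hg : ∀ i, HasLaw (g i) (gaussianReal 0 1) P)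
    (hind : iIndepFun g P) (u v : ι → ℝ) :
    HasGaussianLaw (fun ω => (∑ i, u i * g i ω, ∑ i, v i * g i ω)) P := by
  have h := hind.hasGaussianLaw fun i => (hg i).hasGaussianLaw
  let L : (ι → ℝ) →L[ℝ] ℝ × ℝ :=
    (∑ i, u i • ContinuousLinearMap.proj i).prod (∑ i, v i • ContinuousLinearMap.proj i)
  have := h.map_fun L
  simpa [L, _root_.sum_apply] using this

theorem integral_linear_eq_zero (hg : ∀ i, HasLaw (g i) (gaussianReal 0 1) P) (u : ι → ℝ) :
    ∫ ω, ∑ i, u i * g i ω ∂P = 0 := by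
  rw [integral_finsetSum _ fun i _ => ((hg i).hasGaussianLaw.integrable).const_mul _]
  refine Finset.sum_eq_zero fun i _ => ?_
  rw [integral_const_mul, (hg i).integral_eq, integral_id_gaussianReal, mul_zero]

omit [Fintype ι] in
theorem integral_mul_of_standard [DecidableEq ι] (hg : ∀ i, HasLaw (g i) (gaussianReal 0 1) P)
    (hind : iIndepFun g P) (i j : ι) : ∫ ω, g i ω * g j ω ∂P = if i = j then 1 else 0 := by
  have h0 : ∀ k, ∫ ω, g k ω ∂P = 0 := fun k => by
    rw [(hg k).integral_eq, integral_id_gaussianReal]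
  split_ifs with h
  · subst h
    have := (hg i).isProbabilityMeasure
    have h1 := variance_of_integral_eq_zero (hg i).aemeasurable (h0 i)
    rw [(hg i).variance_eq, variance_id_gaussianReal] at h1
    simp only [NNReal.coe_one, pow_two] at h1
    exact h1.symm
  · rw [(hind.indepFun h).integral_fun_mul_eq_mul_integral
      (hg i).aemeasurable.aestronglyMeasurable (hg j).aemeasurable.aestronglyMeasurable, h0, zero_mul]

theorem integral_linear_mul_linear (hg : ∀ i, HasLaw (g i) (gaussianReal 0 1) P)
    (hind : iIndepFun g P) (u v : ι → ℝ) :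
    ∫ ω, (∑ i, u i * g i ω) * (∑ i, v i * g i ω) ∂P = u ⬝ᵥ v := by
  classical
  have hint : ∀ i j, Integrable (fun ω => g i ω * g j ω) P := fun i j =>
    (hg i).hasGaussianLaw.memLp_two.integrable_mul (hg j).hasGaussianLaw.memLp_two
  have : ∀ ω, (∑ i, u i * g i ω) * (∑ i, v i * g i ω)
      = ∑ i, ∑ j, u i * v j * (g i ω * g j ω) := fun ω => by
    rw [Finset.sum_mul_sum]; refine Finset.sum_congr rfl fun i _ => Finset.sum_congr rfl fun j _ => ?_
    ring
  simp_rw [this]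
  rw [integral_finsetSum _ fun i _ => integrable_finsetSum _ fun j _ => (hint i j).const_mul _]
  simp_rw [integral_finsetSum Finset.univ fun j _ => (hint _ j).const_mul _, integral_const_mul,
    integral_mul_of_standard hg hind, mul_ite, mul_one, mul_zero, Finset.sum_ite_eq, Finset.mem_univ,
    if_true, dotProduct]

theorem hasLaw_linear_of_unit (hg : ∀ i, HasLaw (g i) (gaussianReal 0 1) P)
    (hind : iIndepFun g P) {u : ι → ℝ} (hu : u ⬝ᵥ u = 1) :
    HasLaw (fun ω => ∑ i, u i * g i ω) (gaussianReal 0 1) P := by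
  have h := (hasGaussianLaw_linear_pair hg hind u u).fst
  have := h.isProbabilityMeasure
  refine ⟨h.aemeasurable, ?_⟩
  rw [h.map_eq_gaussianReal, integral_linear_eq_zero hg]
  congr
  rw [variance_of_integral_eq_zero h.aemeasurable (integral_linear_eq_zero hg u)]
  simp_rw [pow_two, integral_linear_mul_linear hg hind u u, hu]
  simp

/-- Grothendieck's identity for the sign of one Gaussian and the value of another one. -/
theorem integral_sign_mul_linear (hg : ∀ i, HasLaw (g i) (gaussianReal 0 1) P)
    (hind : iIndepFun g P) {u : ι → ℝ} (hu : u ⬝ᵥ u = 1) (v : ι → ℝ) :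
    ∫ ω, signPM (∑ i, u i * g i ω) * (∑ i, v i * g i ω) ∂P = √(2 / Real.pi) * (u ⬝ᵥ v) := by
  set c := u ⬝ᵥ v with hc
  -- Split `v` into its component along `u` and an orthogonal remainder. The linear form of the
  -- remainder is uncorrelated with that of `u`, hence independent by joint Gaussianity, and
  -- contributes zero; the component along `u` contributes `c * E |N|`.
  set w : ι → ℝ := v - c • u with hw
  have huw : u ⬝ᵥ w = 0 := by
    rw [hw, dotProduct_sub, dotProduct_smul, hu, ← hc]; simp
  have hpair := hasGaussianLaw_linear_pair hg hind u w
  have hlaw := hasLaw_linear_of_unit hg hind hu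
  have := hpair.isProbabilityMeasure
  have hI : IndepFun (fun ω => ∑ i, u i * g i ω) (fun ω => ∑ i, w i * g i ω) P := by
    apply hpair.indepFun_of_covariance_eq_zero
    rw [covariance_eq_sub hpair.fst.memLp_two hpair.snd.memLp_two]
    simp only [Pi.mul_apply]
    rw [integral_linear_mul_linear hg hind, integral_linear_eq_zero hg, huw, zero_mul, sub_zero]
  have hI2 : IndepFun (fun ω => signPM (∑ i, u i * g i ω)) (fun ω => ∑ i, w i * g i ω) P :=
    hI.comp measurable_signPM measurable_id
  have e : ∀ ω, signPM (∑ i, u i * g i ω) * (∑ i, v i * g i ω)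
      = c * |∑ i, u i * g i ω| + signPM (∑ i, u i * g i ω) * (∑ i, w i * g i ω) := fun ω => by
    have : ∑ i, v i * g i ω = c * (∑ i, u i * g i ω) + ∑ i, w i * g i ω := by
      rw [Finset.mul_sum, ← Finset.sum_add_distrib]
      refine Finset.sum_congr rfl fun i _ => ?_
      simp [hw]; ring
    rw [this, ← signPM_mul_self_eq_abs]; ring
  simp_rw [e]
  have hmeas : AEStronglyMeasurable (fun ω => signPM (∑ i, u i * g i ω)) P :=
    (measurable_signPM.comp_aemeasurable hpair.fst.aemeasurable).aestronglyMeasurable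
  rw [integral_add, integral_const_mul, hI2.integral_fun_mul_eq_mul_integral hmeas
      hpair.snd.aemeasurable.aestronglyMeasurable, integral_linear_eq_zero hg, mul_zero, add_zero]
  · have : ∫ ω, |∑ i, u i * g i ω| ∂P = ∫ x, |x| ∂gaussianReal 0 1 := by
      rw [← hlaw.map_eq, integral_map hlaw.aemeasurable (by fun_prop)]
    rw [this, integral_abs_gaussianReal, mul_comm]
  · exact (hpair.fst.integrable.abs).const_mul c
  · refine hpair.snd.integrable.bdd_mul (c := 1) hmeas (ae_of_all _ fun ω => ?_)
    rw [Real.norm_eq_abs, abs_signPM]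
end

/-! ### Correlations of signs -/

section
variable {Ω ι κ : Type*} [MeasurableSpace Ω] [Fintype ι] {P : Measure Ω} {g : ι → Ω → ℝ}

/-- The correlation matrix of the signs of the linear combinations `⟨W a, g⟩`. -/
noncomputable def signCorrelation (P : Measure Ω) (g : ι → Ω → ℝ) (W : Matrix κ ι ℝ) :
    Matrix κ κ ℝ :=
  Matrix.of fun a b => ∫ ω, signPM (∑ i, W a i * g i ω) * signPM (∑ i, W b i * g i ω) ∂P

theorem aestronglyMeasurable_signPM_linear (hg : ∀ i, HasLaw (g i) (gaussianReal 0 1) P)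
    (u : ι → ℝ) : AEStronglyMeasurable (fun ω => signPM (∑ i, u i * g i ω)) P := by
  refine (measurable_signPM.comp_aemeasurable ?_).aestronglyMeasurable
  exact Finset.aemeasurable_fun_sum _ fun i _ => (hg i).aemeasurable.const_mul _

theorem integrable_linear (hg : ∀ i, HasLaw (g i) (gaussianReal 0 1) P)
    (u : ι → ℝ) : Integrable (fun ω => ∑ i, u i * g i ω) P :=
  integrable_finsetSum _ fun i _ => ((hg i).hasGaussianLaw.integrable).const_mul _

theorem integrable_signPM_mul_linear (hg : ∀ i, HasLaw (g i) (gaussianReal 0 1) P)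
    (u v : ι → ℝ) :
    Integrable (fun ω => signPM (∑ i, u i * g i ω) * ∑ i, v i * g i ω) P := by
  refine (integrable_linear hg v).bdd_mul (c := 1) (aestronglyMeasurable_signPM_linear hg u)
    (ae_of_all _ fun ω => ?_)
  rw [Real.norm_eq_abs, abs_signPM]

theorem integrable_signPM_mul_signPM [IsProbabilityMeasure P]
    (hg : ∀ i, HasLaw (g i) (gaussianReal 0 1) P) (u v : ι → ℝ) :
    Integrable (fun ω => signPM (∑ i, u i * g i ω) * signPM (∑ i, v i * g i ω)) P := by
  refine Integrable.of_bound ((aestronglyMeasurable_signPM_linear hg u).mul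
    (aestronglyMeasurable_signPM_linear hg v)) 1 (ae_of_all _ fun ω => ?_)
  rw [Real.norm_eq_abs, abs_mul, abs_signPM, abs_signPM, one_mul]

theorem integrable_linear_mul_linear [IsProbabilityMeasure P]
    (hg : ∀ i, HasLaw (g i) (gaussianReal 0 1) P) (hind : iIndepFun g P) (u v : ι → ℝ) :
    Integrable (fun ω => (∑ i, u i * g i ω) * ∑ i, v i * g i ω) P := by
  have h := hasGaussianLaw_linear_pair hg hind u v
  exact h.fst.memLp_two.integrable_mul h.snd.memLp_two

theorem signCorrelation_diag [IsProbabilityMeasure P] (W : Matrix κ ι ℝ) (a : κ) :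
    signCorrelation P g W a a = 1 := by
  simp [signCorrelation, signPM_mul_self_eq_one]

/-- The quadratic form at `c` is the second moment of `∑ a, c a * f a`. It is applied both to the
signs and to the residuals in Rietz' inequality. -/
theorem posSemidef_of_integral [Fintype κ] (f : κ → Ω → ℝ)
    (hf : ∀ a b, Integrable (fun ω => f a ω * f b ω) P) :
    (Matrix.of fun a b => ∫ ω, f a ω * f b ω ∂P : Matrix κ κ ℝ).PosSemidef := by
  refine Matrix.PosSemidef.of_dotProduct_mulVec_nonneg ?_ fun c => ?_
  · ext a b; simp [mul_comm]
  · have : star c ⬝ᵥ ((Matrix.of fun a b => ∫ ω, f a ω * f b ω ∂P : Matrix κ κ ℝ) *ᵥ c)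
        = ∫ ω, (∑ a, c a * f a ω) ^ 2 ∂P := by
      have e : ∀ ω, (∑ a, c a * f a ω) ^ 2 = ∑ a, ∑ b, c a * c b * (f a ω * f b ω) := fun ω => by
        rw [pow_two, Finset.sum_mul_sum]
        refine Finset.sum_congr rfl fun i _ => Finset.sum_congr rfl fun j _ => ?_
        ring
      simp_rw [e]
      rw [integral_finsetSum _ fun i _ => integrable_finsetSum _ fun j _ => (hf i j).const_mul _]
      simp_rw [integral_finsetSum Finset.univ fun j _ => (hf _ j).const_mul _, integral_const_mul]
      simp only [dotProduct, Matrix.mulVec, Matrix.of_apply, Finset.mul_sum, star_trivial]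
      refine Finset.sum_congr rfl fun i _ => Finset.sum_congr rfl fun j _ => ?_
      ring
    rw [this]
    exact integral_nonneg fun ω => sq_nonneg _

theorem signCorrelation_posSemidef [Fintype κ] [IsProbabilityMeasure P]
    (hg : ∀ i, HasLaw (g i) (gaussianReal 0 1) P) (W : Matrix κ ι ℝ) :
    (signCorrelation P g W).PosSemidef :=
  posSemidef_of_integral (fun a ω => signPM (∑ i, W a i * g i ω))
    fun a b => integrable_signPM_mul_signPM hg (W a) (W b)

/-- Rietz' inequality: the sign correlations exceed `2 / π` times the Gram matrix. -/
theorem signCorrelation_sub_posSemidef [Fintype κ] [IsProbabilityMeasure P]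
    (hg : ∀ i, HasLaw (g i) (gaussianReal 0 1) P) (hind : iIndepFun g P) {W : Matrix κ ι ℝ}
    (hW : ∀ a, W a ⬝ᵥ W a = 1) :
    (signCorrelation P g W - (2 / Real.pi) • (W * Wᵀ)).PosSemidef := by
  -- The difference is the second moment matrix of the residuals `sign z - k z`: by Grothendieck's
  -- identity each of the two cross terms equals `-k ^ 2` times the Gram matrix, and the quadratic
  -- term gives back `k ^ 2` times it.
  set k := √(2 / Real.pi) with hk
  have hk2 : k * k = 2 / Real.pi := Real.mul_self_sqrt (by positivity)
  have e : ∀ a b ω, (signPM (∑ i, W a i * g i ω) - k * ∑ i, W a i * g i ω) *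
      (signPM (∑ i, W b i * g i ω) - k * ∑ i, W b i * g i ω)
      = signPM (∑ i, W a i * g i ω) * signPM (∑ i, W b i * g i ω)
        - k * (signPM (∑ i, W a i * g i ω) * ∑ i, W b i * g i ω)
        - k * (signPM (∑ i, W b i * g i ω) * ∑ i, W a i * g i ω)
        + k * k * ((∑ i, W a i * g i ω) * ∑ i, W b i * g i ω) := fun a b ω => by ring
  have i1 := fun a b => integrable_signPM_mul_signPM hg (W a) (W b)
  have i2 := fun a b => (integrable_signPM_mul_linear hg (W a) (W b)).const_mul k
  have i3 := fun a b => (integrable_linear_mul_linear hg hind (W a) (W b)).const_mul (k * k)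
  have i12 : ∀ a b, Integrable (fun ω => signPM (∑ i, W a i * g i ω) * signPM (∑ i, W b i * g i ω)
      - k * (signPM (∑ i, W a i * g i ω) * ∑ i, W b i * g i ω)) P := fun a b => (i1 a b).sub (i2 a b)
  have i123 : ∀ a b, Integrable (fun ω => signPM (∑ i, W a i * g i ω) * signPM (∑ i, W b i * g i ω)
      - k * (signPM (∑ i, W a i * g i ω) * ∑ i, W b i * g i ω)
      - k * (signPM (∑ i, W b i * g i ω) * ∑ i, W a i * g i ω)) P :=
    fun a b => (i12 a b).sub (i2 b a)
  have := posSemidef_of_integral (P := P)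
    (fun a ω => signPM (∑ i, W a i * g i ω) - k * ∑ i, W a i * g i ω) fun a b => by
      simp_rw [e]
      exact (i123 a b).add (i3 a b)
  convert this using 1
  ext a b
  simp only [Matrix.sub_apply, Matrix.of_apply, signCorrelation, Matrix.smul_apply, smul_eq_mul]
  simp_rw [e]
  rw [integral_add (i123 a b) (i3 a b), integral_sub (i12 a b) (i2 b a), integral_sub (i1 a b) (i2 a b)]
  simp_rw [integral_const_mul]
  rw [integral_sign_mul_linear hg hind (hW a), integral_sign_mul_linear hg hind (hW b),
    integral_linear_mul_linear hg hind, ← hk, ← hk2]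
  have : (W * Wᵀ) a b = W a ⬝ᵥ W b := rfl
  rw [this, dotProduct_comm (W b) (W a)]
  ring

/-- The signs of two Gaussians that are close to each other are mostly equal. -/
theorem two_sub_signCorrelation_le [IsProbabilityMeasure P]
    (hg : ∀ i, HasLaw (g i) (gaussianReal 0 1) P) (hind : iIndepFun g P) {W : Matrix κ ι ℝ}
    (hW : ∀ a, W a ⬝ᵥ W a = 1) (a b : κ) {τ : ℝ} (hτ : 0 < τ) :
    2 - 2 * signCorrelation P g W a b ≤ 4 * τ + (2 - 2 * (W * Wᵀ) a b) / τ := by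
  have hlaw := hasLaw_linear_of_unit hg hind (hW a)
  set Z := fun ω => ∑ i, W a i * g i ω with hZ
  set Y := fun ω => ∑ i, W b i * g i ω with hY
  have i1 := (integrable_signPM_mul_signPM hg (W a) (W b))
  have i2 := (integrable_signPM_mul_linear hg (W a) (W a))
  have i3 := (integrable_signPM_mul_linear hg (W b) (W a))
  have i23 : Integrable (fun ω => signPM (∑ i, W a i * g i ω) * ∑ i, W a i * g i ω
      - signPM (∑ i, W b i * g i ω) * ∑ i, W a i * g i ω) P := i2.sub i3
  have hms : NullMeasurableSet {ω | |Z ω| ≤ τ} P :=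
    hlaw.aemeasurable.nullMeasurableSet_preimage (s := {x | |x| ≤ τ})
      (measurableSet_le (by fun_prop) (by fun_prop))
  -- If the signs agree, the left side is zero. If they differ, it is `4`: either `|Z| ≤ τ` and the
  -- indicator pays for it, or `|Z| - sign(Y) Z = 2 |Z| > 2 τ`. The expectation of `|Z| - sign(Y) Z`
  -- is known from Grothendieck's identity.
  have hpt : ∀ ω, 2 - 2 * (signPM (Z ω) * signPM (Y ω)) ≤
      4 * Set.indicator {ω | |Z ω| ≤ τ} 1 ω
        + (2 / τ) * (signPM (Z ω) * Z ω - signPM (Y ω) * Z ω) := fun ω => by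
    have h1 : 0 ≤ signPM (Z ω) * Z ω - signPM (Y ω) * Z ω := by
      rw [signPM_mul_self_eq_abs]
      rcases signPM_eq_or (Y ω) with h | h <;> rw [h] <;>
        nlinarith [le_abs_self (Z ω), neg_abs_le (Z ω)]
    by_cases hz : |Z ω| ≤ τ
    · rw [Set.indicator_of_mem (by exact hz)]
      have h2 : 0 ≤ (2 / τ) * (signPM (Z ω) * Z ω - signPM (Y ω) * Z ω) := by positivity
      have h3 : -1 ≤ signPM (Z ω) * signPM (Y ω) := by
        have := neg_abs_le (signPM (Z ω) * signPM (Y ω))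
        rwa [abs_mul, abs_signPM, abs_signPM, one_mul] at this
      simp only [Pi.one_apply]; linarith
    · rw [Set.indicator_of_notMem (by exact hz)]
      have h4 : signPM (Z ω) * Z ω - signPM (Y ω) * Z ω
          = |Z ω| * (1 - signPM (Z ω) * signPM (Y ω)) := by
        rw [← signPM_mul_self_eq_abs]
        linear_combination (-(signPM (Y ω)) * Z ω) * (-signPM_mul_self_eq_one (Z ω))
      have h5 : 0 ≤ 1 - signPM (Z ω) * signPM (Y ω) := by
        have := le_abs_self (signPM (Z ω) * signPM (Y ω))
        rw [abs_mul, abs_signPM, abs_signPM, one_mul] at this; linarith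
      rw [h4, div_mul_eq_mul_div, mul_zero, zero_add, le_div_iff₀ hτ]
      nlinarith
  have hint := integral_mono ((integrable_const (2:ℝ)).sub (i1.const_mul 2))
    ((((integrable_const (1:ℝ)).indicator₀ hms).const_mul 4).add
      (i23.const_mul (2 / τ))) hpt
  simp only [Pi.sub_apply, Pi.add_apply] at hint
  rw [integral_sub (integrable_const _) (i1.const_mul 2), integral_const_mul,
    integral_add (((integrable_const (1:ℝ)).indicator₀ hms).const_mul 4)
      (i23.const_mul (2 / τ)), integral_const_mul, integral_const_mul,
    integral_sub i2 i3, integral_sign_mul_linear hg hind (hW a),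
    integral_sign_mul_linear hg hind (hW b), hW a] at hint
  have hp : ∫ ω, Set.indicator {ω | |Z ω| ≤ τ} (fun _ => (1:ℝ)) ω ∂P ≤ τ := by
    rw [integral_indicator₀ hms, setIntegral_const, smul_eq_mul, mul_one]
    have : P.real {ω | |Z ω| ≤ τ} = (gaussianReal 0 1).real {x | |x| ≤ τ} := by
      rw [measureReal_def, measureReal_def, ← hlaw.map_eq,
        Measure.map_apply_of_aemeasurable hlaw.aemeasurable
          (measurableSet_le (by fun_prop) (by fun_prop))]
      rfl
    rw [this]; exact gaussianReal_abs_le τ hτ.le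
  have hk : √(2 / Real.pi) ≤ 1 := by
    rw [Real.sqrt_le_iff, one_pow, div_le_one Real.pi_pos]
    exact ⟨zero_le_one, by linarith [Real.pi_gt_three]⟩
  have hG : (W * Wᵀ) a b = W b ⬝ᵥ W a := dotProduct_comm _ _
  have hG1 : W b ⬝ᵥ W a ≤ 1 := by
    have h : 0 ≤ (W a - W b) ⬝ᵥ (W a - W b) := by
      rw [dotProduct]; exact Finset.sum_nonneg fun i _ => mul_self_nonneg _
    rw [sub_dotProduct, dotProduct_sub, dotProduct_sub, hW, hW, dotProduct_comm (W a) (W b)] at h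
    linarith
  have hs : signCorrelation P g W a b = ∫ ω, signPM (Z ω) * signPM (Y ω) ∂P := rfl
  rw [hs, hG]
  simp only [integral_const, probReal_univ, smul_eq_mul, one_mul] at hint
  have h6 : 2 / τ * (√(2 / Real.pi) * 1 - √(2 / Real.pi) * (W b ⬝ᵥ W a)) ≤
      (2 - 2 * (W b ⬝ᵥ W a)) / τ := by
    rw [div_mul_eq_mul_div]
    gcongr
    nlinarith
  refine hint.trans ?_
  have : ∫ ω, Set.indicator {ω | |Z ω| ≤ τ} 1 ω ∂P ≤ τ := hp
  linarith
end

/-! ### Frobenius norm and traces against Gram matrices -/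

section
variable {ι κ μ : Type*} [Fintype ι] [Fintype κ] [Fintype μ]

theorem Matrix.PosSemidef.trace_mul_nonneg {M N : Matrix ι ι ℝ} (hM : M.PosSemidef)
    (hN : N.PosSemidef) : 0 ≤ (M * N).trace := by
  obtain ⟨m, v, rfl⟩ := Matrix.posSemidef_iff_eq_sum_vecMulVec.mp hN
  rw [Matrix.mul_sum, Matrix.trace_sum]
  refine Finset.sum_nonneg fun k _ => ?_
  rw [Matrix.mul_vecMulVec, Matrix.trace_vecMulVec, dotProduct_comm]
  exact hM.dotProduct_mulVec_nonneg (v k)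

/-- The squared Frobenius norm. -/
def frobeniusSq (M : Matrix ι κ ℝ) : ℝ := ∑ j, ∑ i, M i j ^ 2

theorem frobeniusSq_nonneg (M : Matrix ι κ ℝ) : 0 ≤ frobeniusSq M :=
  Finset.sum_nonneg fun _ _ => Finset.sum_nonneg fun _ _ => sq_nonneg _

theorem frobeniusSq_eq_trace (M : Matrix ι κ ℝ) : frobeniusSq M = (M * Mᵀ).trace := by
  rw [frobeniusSq, Finset.sum_comm]
  simp [Matrix.trace, Matrix.mul_apply, pow_two]

theorem frobeniusSq_eq_sum_norm (M : Matrix ι κ ℝ) :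
    frobeniusSq M = ∑ j, ‖WithLp.toLp 2 (M.col j)‖ ^ 2 := by
  simp [frobeniusSq, EuclideanSpace.norm_sq_eq, Matrix.col]

theorem frobeniusSq_mul_le [DecidableEq ι] (M : Matrix μ ι ℝ) (N : Matrix ι κ ℝ) :
    frobeniusSq (M * N) ≤ ‖M‖ ^ 2 * frobeniusSq N := by
  rw [frobeniusSq_eq_sum_norm, frobeniusSq_eq_sum_norm, Finset.mul_sum]
  refine Finset.sum_le_sum fun j _ => ?_
  rw [← mul_pow]
  gcongr
  exact Matrix.l2_opNorm_mulVec M (WithLp.toLp 2 (N.col j))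

/-- The trace is a sum of inner products of columns; Cauchy–Schwarz is used for each column and then
for the sum over the columns. -/
theorem abs_trace_le_norm_mul [DecidableEq ι] (M : Matrix ι ι ℝ) (U V : Matrix ι κ ℝ) :
    |(Uᵀ * M * V).trace| ≤ ‖M‖ * (√(frobeniusSq U) * √(frobeniusSq V)) := by
  have e : (Uᵀ * M * V).trace
      = ∑ j, inner ℝ (WithLp.toLp 2 (U.col j)) (WithLp.toLp 2 (M *ᵥ V.col j)) := by
    rw [Matrix.mul_assoc]
    simp only [Matrix.trace, Matrix.diag, Matrix.mul_apply, Matrix.transpose_apply,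
      PiLp.inner_apply, Matrix.mulVec, dotProduct, Matrix.col, RCLike.inner_apply, conj_trivial]
    refine Finset.sum_congr rfl fun j _ => Finset.sum_congr rfl fun i _ => mul_comm _ _
  rw [e]
  calc _ ≤ ∑ j, |inner ℝ (WithLp.toLp 2 (U.col j)) (WithLp.toLp 2 (M *ᵥ V.col j))| :=
        Finset.abs_sum_le_sum_abs _ _
    _ ≤ ∑ j, ‖M‖ * (‖WithLp.toLp 2 (U.col j)‖ * ‖WithLp.toLp 2 (V.col j)‖) := by
        refine Finset.sum_le_sum fun j _ => (abs_real_inner_le_norm _ _).trans ?_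
        have := Matrix.l2_opNorm_mulVec M (WithLp.toLp 2 (V.col j))
        calc _ ≤ ‖WithLp.toLp 2 (U.col j)‖ * (‖M‖ * ‖WithLp.toLp 2 (V.col j)‖) := by
              gcongr; exact this
          _ = _ := by ring
    _ = ‖M‖ * ∑ j, ‖WithLp.toLp 2 (U.col j)‖ * ‖WithLp.toLp 2 (V.col j)‖ := by
        rw [Finset.mul_sum]
    _ ≤ _ := by
        rw [frobeniusSq_eq_sum_norm, frobeniusSq_eq_sum_norm]
        gcongr
        exact Real.sum_mul_le_sqrt_mul_sqrt _ _ _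

/-- Replace the two factors of the Gram matrix one at a time. The bound is linear in the Frobenius
distance of the factors, so closeness is only ever needed for square roots of states. -/
theorem abs_trace_mul_gram_sub_le [DecidableEq ι] (M : Matrix ι ι ℝ) {U V : Matrix ι κ ℝ}
    (hU : frobeniusSq U = 1) (hV : frobeniusSq V = 1) :
    |(M * (U * Uᵀ)).trace - (M * (V * Vᵀ)).trace| ≤ ‖M‖ * (2 * √(frobeniusSq (U - V))) := by
  have cyc : ∀ X Y : Matrix ι κ ℝ, (M * (Y * Xᵀ)).trace = (Xᵀ * M * Y).trace := fun X Y => by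
    rw [← Matrix.mul_assoc, Matrix.trace_mul_comm, Matrix.mul_assoc]
  have e : (M * (U * Uᵀ)).trace - (M * (V * Vᵀ)).trace
      = ((U - V)ᵀ * M * U).trace + (Vᵀ * M * (U - V)).trace := by
    rw [cyc, cyc, Matrix.transpose_sub, Matrix.sub_mul, Matrix.sub_mul, Matrix.mul_sub,
      Matrix.trace_sub, Matrix.trace_sub]; ring
  rw [e]
  have h1 := abs_trace_le_norm_mul M (U - V) U
  have h2 := abs_trace_le_norm_mul M V (U - V)
  rw [hU, Real.sqrt_one, mul_one] at h1
  rw [hV, Real.sqrt_one, one_mul] at h2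
  refine (abs_add_le _ _).trans ?_
  linarith

theorem abs_trace_mul_gram_le [DecidableEq ι] (M : Matrix ι ι ℝ) {U : Matrix ι κ ℝ}
    (hU : frobeniusSq U = 1) : |(M * (U * Uᵀ)).trace| ≤ ‖M‖ := by
  have h1 := abs_trace_le_norm_mul M U U
  rwa [hU, Real.sqrt_one, mul_one, mul_one, Matrix.mul_assoc, Matrix.trace_mul_comm,
    Matrix.mul_assoc] at h1

end

/-- The image of `(u, v)` is `(A v, Aᵀ u)`, and `A` and its transpose have the same norm; vectors
`(0, v)` give the reverse inequality. -/
theorem norm_bipartiteMatrix {n : ℕ} (A : Matrix (Fin n) (Fin n) ℝ) :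
    ‖bipartiteMatrix A‖ = ‖A‖ := by
  have hT : ‖Aᵀ‖ = ‖A‖ := by
    rw [← Matrix.conjTranspose_eq_transpose_of_trivial, Matrix.l2_opNorm_conjTranspose]
  apply le_antisymm
  · rw [Matrix.l2_opNorm_def]
    refine ContinuousLinearMap.opNorm_le_bound _ (norm_nonneg _) fun x => ?_
    rw [← sq_le_sq₀ (norm_nonneg _) (by positivity), mul_pow]
    set u : Fin n → ℝ := fun i => x (Sum.inl i) with hu
    set v : Fin n → ℝ := fun i => x (Sum.inr i) with hv
    have hx : ‖x‖ ^ 2 = ‖WithLp.toLp 2 u‖ ^ 2 + ‖WithLp.toLp 2 v‖ ^ 2 := by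
      simp [EuclideanSpace.norm_sq_eq, Fintype.sum_sum_type, hu, hv]
    have hy : ‖Matrix.toEuclideanLin (bipartiteMatrix A) x‖ ^ 2
        = ‖WithLp.toLp 2 (A *ᵥ v)‖ ^ 2 + ‖WithLp.toLp 2 (Aᵀ *ᵥ u)‖ ^ 2 := by
      simp [EuclideanSpace.norm_sq_eq, Fintype.sum_sum_type, bipartiteMatrix, Matrix.mulVec,
        dotProduct, hu, hv]
    have h1 := Matrix.l2_opNorm_mulVec A (WithLp.toLp 2 v)
    have h2 := Matrix.l2_opNorm_mulVec Aᵀ (WithLp.toLp 2 u)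
    rw [hT] at h2
    have h1' := pow_le_pow_left₀ (norm_nonneg _) h1 2
    have h2' := pow_le_pow_left₀ (norm_nonneg _) h2 2
    rw [mul_pow] at h1' h2'
    change ‖Matrix.toEuclideanLin (bipartiteMatrix A) x‖ ^ 2 ≤ _
    rw [hx, hy]
    have e1 : ‖WithLp.toLp 2 (A *ᵥ v)‖ ^ 2 ≤ ‖A‖ ^ 2 * ‖WithLp.toLp 2 v‖ ^ 2 := h1'
    have e2 : ‖WithLp.toLp 2 (Aᵀ *ᵥ u)‖ ^ 2 ≤ ‖A‖ ^ 2 * ‖WithLp.toLp 2 u‖ ^ 2 := h2'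
    linarith
  · rw [Matrix.l2_opNorm_def A]
    refine ContinuousLinearMap.opNorm_le_bound _ (norm_nonneg _) fun v => ?_
    have h := Matrix.l2_opNorm_mulVec (bipartiteMatrix A) (WithLp.toLp 2 (Sum.elim 0 v.ofLp))
    have e1 : ‖WithLp.toLp 2 (Sum.elim (0 : Fin n → ℝ) v.ofLp)‖ = ‖v‖ := by
      rw [← sq_eq_sq₀ (norm_nonneg _) (norm_nonneg _)]
      simp [EuclideanSpace.norm_sq_eq, Fintype.sum_sum_type]
    have e2 : ‖WithLp.toLp 2 (bipartiteMatrix A *ᵥ (Sum.elim (0 : Fin n → ℝ) v.ofLp))‖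
        = ‖Matrix.toEuclideanLin A v‖ := by
      rw [← sq_eq_sq₀ (norm_nonneg _) (norm_nonneg _)]
      simp [EuclideanSpace.norm_sq_eq, Fintype.sum_sum_type, bipartiteMatrix, Matrix.mulVec,
        dotProduct]
    rw [e1] at h
    exact e2 ▸ h

/-! ### Correlation matrices and SDP duality -/

section
variable {ι : Type*} [Fintype ι] [DecidableEq ι]

/-- Correlation matrices: psd matrices with unit diagonal. -/
def IsCorrelation (G : Matrix ι ι ℝ) : Prop := G.PosSemidef ∧ ∀ i, G i i = 1

-- Test the quadratic form on `e_i ± e_j`. This is the boundedness needed for compactness of the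
-- feasible set.
omit [DecidableEq ι] in
theorem IsCorrelation.abs_le_one {G : Matrix ι ι ℝ} (hG : IsCorrelation G) (i j : ι) :
    |G i j| ≤ 1 := by
  classical
  have hs : G j i = G i j := by simpa using congrFun (congrFun hG.1.isHermitian i) j
  have key : ∀ c : ℝ, 0 ≤ 1 + c * c + 2 * c * G i j := fun c => by
    have h := hG.1.dotProduct_mulVec_nonneg (Pi.single i 1 + c • Pi.single j 1)
    simp only [star_trivial, Matrix.mulVec_add, Matrix.mulVec_smul, add_dotProduct, dotProduct_add,
      smul_dotProduct, dotProduct_smul, Matrix.mulVec_single_one, single_one_dotProduct,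
      Matrix.col_apply, hG.2, hs, smul_eq_mul] at h
    linarith
  rw [abs_le]
  constructor <;> [have := key 1; have := key (-1)] <;> linarith

omit [DecidableEq ι] in
theorem isCompact_isCorrelation : IsCompact {G : Matrix ι ι ℝ | IsCorrelation G} := by
  have hc : IsCompact (Set.univ.pi fun _ : ι => Set.univ.pi fun _ : ι => Set.Icc (-1 : ℝ) 1) :=
    isCompact_univ_pi fun _ => isCompact_univ_pi fun _ => isCompact_Icc
  refine hc.of_isClosed_subset ?_ fun G hG i _ j _ => ?_
  · have : {G : Matrix ι ι ℝ | IsCorrelation G} = {G | Gᴴ = G} ∩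
        ((⋂ x : ι → ℝ, {G | 0 ≤ star x ⬝ᵥ (G *ᵥ x)}) ∩ ⋂ i, {G | G i i = 1}) := by
      ext G
      simp [IsCorrelation, Matrix.posSemidef_iff_dotProduct_mulVec, Matrix.IsHermitian, and_assoc]
    rw [this]
    refine (isClosed_eq (by fun_prop) continuous_id).inter
      ((isClosed_iInter fun x => isClosed_le continuous_const ?_).inter
        (isClosed_iInter fun i => isClosed_eq ?_ continuous_const))
    · exact Continuous.dotProduct continuous_const
        (Continuous.matrix_mulVec continuous_id continuous_const)
    · exact continuous_id.matrix_elem i i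
  · exact abs_le.1 (IsCorrelation.abs_le_one hG i j)

/-- Moving every vector of a Gram matrix towards a common orthogonal direction. -/
theorem IsCorrelation.perturb {G : Matrix ι ι ℝ} (hG : IsCorrelation G) (t : ι → ℝ) {σ : ℝ}
    (hσ : 0 ≤ σ) (ht : ∀ i, σ * t i ^ 2 ≤ 1) :
    IsCorrelation (Matrix.of fun i j =>
      √(1 - σ * t i ^ 2) * √(1 - σ * t j ^ 2) * G i j + σ * (t i * t j)) := by
  constructor
  · have h1 := hG.1.mul_mul_conjTranspose_same (Matrix.diagonal fun i => √(1 - σ * t i ^ 2))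
    have h2 := (Matrix.posSemidef_vecMulVec_self_star t).smul hσ
    convert h1.add h2 using 1
    ext i j
    simp [Matrix.diagonal_mul, Matrix.mul_diagonal, Matrix.vecMulVec_apply]
    ring
  · intro i
    simp only [Matrix.of_apply, hG.2, mul_one]
    rw [Real.mul_self_sqrt (by linarith [ht i])]
    ring

/-- Strong duality for the MaxQP SDP of a symmetric matrix. -/
theorem exists_dual_optimal {A : Matrix ι ι ℝ} (hA : A.IsSymm) :
    ∃ (G : Matrix ι ι ℝ) (w : ι → ℝ), IsCorrelation G ∧ ∑ i, w i = (A * G).trace ∧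
      (Matrix.diagonal w - A).PosSemidef := by
  have hne : {G : Matrix ι ι ℝ | IsCorrelation G}.Nonempty :=
    ⟨1, Matrix.PosSemidef.one, fun i => Matrix.one_apply_eq i⟩
  have hcont : Continuous fun G : Matrix ι ι ℝ => (A * G).trace := by fun_prop
  -- No separation argument is needed: the weights are the diagonal of `A * G` for a primal
  -- maximizer, and dual feasibility is its first order optimality condition.
  obtain ⟨G, hG, hmax⟩ := isCompact_isCorrelation.exists_isMaxOn hne hcont.continuousOn
  have hGs : ∀ i j, G j i = G i j := fun i j => by
    simpa using congrFun (congrFun hG.1.isHermitian i) j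
  refine ⟨G, fun i => ∑ j, A i j * G i j, hG, ?_, ?_⟩
  · simp only [Matrix.trace, Matrix.diag, Matrix.mul_apply]
    exact Finset.sum_congr rfl fun i _ => Finset.sum_congr rfl fun j _ => by rw [hGs i j]
  refine Matrix.PosSemidef.of_dotProduct_mulVec_nonneg ?_ fun t => ?_
  · rw [Matrix.IsHermitian, Matrix.conjTranspose_eq_transpose_of_trivial, Matrix.transpose_sub,
      Matrix.diagonal_transpose, hA.eq]
  -- The objective along `IsCorrelation.perturb` in direction `t`. Its derivative at `0` is `⟨t, A
  -- t⟩ - ∑ w i * t i ^ 2`. Only `σ ≥ 0` is admissible, but a right derivative at a maximum is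
  -- already nonpositive.
  set f : ℝ → ℝ := fun σ => ∑ i, ∑ j, A i j *
    (√(1 - σ * t j ^ 2) * √(1 - σ * t i ^ 2) * G j i + σ * (t j * t i)) with hf
  have hsq : ∀ i, HasDerivAt (fun σ : ℝ => √(1 - σ * t i ^ 2)) (-(t i ^ 2) / 2) 0 := fun i => by
    have h1 : HasDerivAt (fun σ : ℝ => 1 - σ * t i ^ 2) (-(1 * t i ^ 2)) 0 :=
      ((hasDerivAt_id (0:ℝ)).mul_const (t i ^ 2)).const_sub 1
    have := h1.sqrt (by simp)
    simpa using this
  have hderiv : HasDerivAt f (∑ i, ∑ j, A i j * ((-(t j ^ 2) / 2 + -(t i ^ 2) / 2) * G j i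
      + t j * t i)) 0 := by
    refine HasDerivAt.fun_sum fun i _ => HasDerivAt.fun_sum fun j _ => ?_
    have h1 := (((hsq j).mul (hsq i)).mul_const (G j i)).add
      ((hasDerivAt_id (0:ℝ)).mul_const (t j * t i))
    exact (h1.const_mul (A i j)).congr_deriv (by simp)
  have hle : (∑ i, ∑ j, A i j * ((-(t j ^ 2) / 2 + -(t i ^ 2) / 2) * G j i + t j * t i)) ≤ 0 := by
    have h1 := (hasDerivWithinAt_iff_tendsto_slope' (s := Set.Ioi 0) (by simp)).1
      hderiv.hasDerivWithinAt
    refine le_of_tendsto h1 ?_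
    have h2 : ∀ᶠ σ in nhdsWithin (0:ℝ) (Set.Ioi 0), ∀ i, σ * t i ^ 2 ≤ 1 := by
      rw [Filter.eventually_all]
      intro i
      have : Filter.Tendsto (fun σ : ℝ => σ * t i ^ 2) (nhdsWithin 0 (Set.Ioi 0)) (nhds 0) := by
        have hc : Continuous (fun σ : ℝ => σ * t i ^ 2) := by fun_prop
        simpa using (hc.tendsto 0).mono_left nhdsWithin_le_nhds
      exact this.eventually (eventually_le_nhds zero_lt_one)
    filter_upwards [h2, self_mem_nhdsWithin] with σ hσ hpos
    rw [Set.mem_Ioi] at hpos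
    rw [slope_def_field, sub_zero]
    refine div_nonpos_of_nonpos_of_nonneg ?_ hpos.le
    have := hmax (hG.perturb t hpos.le hσ)
    simp only [Set.mem_ofPred_eq, Matrix.trace, Matrix.diag, Matrix.mul_apply, Matrix.of_apply] at this
    have h0 : f 0 = ∑ i, ∑ j, A i j * G j i := by simp [hf]
    rw [h0]; linarith
  have e1 : ∑ i, ∑ j, A i j * ((-(t j ^ 2) / 2 + -(t i ^ 2) / 2) * G j i + t j * t i)
      = -(∑ i, t i ^ 2 * ∑ j, A i j * G i j) + ∑ i, t i * ∑ j, A i j * t j := by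
    have s1 : ∑ i, ∑ j, A i j * (t j ^ 2 * G j i) = ∑ i, t i ^ 2 * ∑ j, A i j * G i j := by
      rw [Finset.sum_comm]
      simp_rw [Finset.mul_sum]
      refine Finset.sum_congr rfl fun i _ => Finset.sum_congr rfl fun j _ => ?_
      rw [hA.apply]; ring
    have s2 : ∑ i, ∑ j, A i j * (t i ^ 2 * G j i) = ∑ i, t i ^ 2 * ∑ j, A i j * G i j := by
      simp_rw [Finset.mul_sum]
      refine Finset.sum_congr rfl fun i _ => Finset.sum_congr rfl fun j _ => ?_
      rw [hGs]; ring
    have s3 : ∑ i, ∑ j, A i j * (t j * t i) = ∑ i, t i * ∑ j, A i j * t j := by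
      simp_rw [Finset.mul_sum]
      refine Finset.sum_congr rfl fun i _ => Finset.sum_congr rfl fun j _ => ?_
      ring
    calc _ = -(1/2) * (∑ i, ∑ j, A i j * (t j ^ 2 * G j i))
          + -(1/2) * (∑ i, ∑ j, A i j * (t i ^ 2 * G j i)) + ∑ i, ∑ j, A i j * (t j * t i) := by
          simp_rw [Finset.mul_sum, ← Finset.sum_add_distrib]
          refine Finset.sum_congr rfl fun i _ => Finset.sum_congr rfl fun j _ => ?_
          ring
      _ = _ := by rw [s1, s2, s3]; ring
  have e2 : star t ⬝ᵥ ((Matrix.diagonal (fun i => ∑ j, A i j * G i j) - A) *ᵥ t)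
      = (∑ i, t i ^ 2 * ∑ j, A i j * G i j) - ∑ i, t i * ∑ j, A i j * t j := by
    rw [Matrix.sub_mulVec, dotProduct_sub]
    congr 1
    simp only [dotProduct, Matrix.mulVec_diagonal, star_trivial]
    exact Finset.sum_congr rfl fun i _ => by ring
  rw [e2]; linarith
end

/-! ### Tail of the exponential series -/

section
variable {𝔸 : Type*} [NormedRing 𝔸] [NormOneClass 𝔸] [NormedAlgebra ℝ 𝔸] [CompleteSpace 𝔸]

/-- Every index in the tail is at least `m`, so each term may be multiplied by `e ^ (index - m) ≥
1`. This bounds the tail by `e ^ (-m)` times the exponential series of `e * ‖x‖`. -/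
theorem norm_exp_sub_sum_le_exp (x : 𝔸) (m : ℕ) :
    ‖NormedSpace.exp x - ∑ k ∈ Finset.range m, ((k.factorial : ℝ)⁻¹) • x ^ k‖ ≤
      Real.exp (Real.exp 1 * ‖x‖ - m) := by
  have h1 := (hasSum_nat_add_iff' m).2 (NormedSpace.exp_series_hasSum_exp' (𝕂 := ℝ) x)
  have h2 := ((hasSum_nat_add_iff' m).2
    (NormedSpace.expSeries_div_hasSum_exp (Real.exp 1 * ‖x‖))).mul_left (Real.exp (-m))
  refine (h1.norm_le_of_bounded h2 fun k => ?_).trans ?_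
  · have h3 : Real.exp 1 ^ m ≤ Real.exp 1 ^ (k + m) :=
      pow_le_pow_right₀ (Real.one_le_exp zero_le_one) (Nat.le_add_left m k)
    have h4 : 1 ≤ Real.exp (-m) * Real.exp 1 ^ (k + m) := by
      have : Real.exp (-m) * Real.exp 1 ^ m = 1 := by
        rw [← Real.exp_nat_mul, mul_one, ← Real.exp_add, neg_add_cancel, Real.exp_zero]
      exact this.symm.le.trans (mul_le_mul_of_nonneg_left h3 (Real.exp_nonneg _))
    rw [norm_smul, norm_inv, Real.norm_natCast, mul_pow]
    calc _ ≤ (((k + m).factorial : ℝ))⁻¹ * ‖x‖ ^ (k + m) := by gcongr; exact norm_pow_le _ _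
      _ ≤ (((k + m).factorial : ℝ))⁻¹ * ‖x‖ ^ (k + m) * (Real.exp (-m) * Real.exp 1 ^ (k + m)) :=
        le_mul_of_one_le_right (by positivity) h4
      _ = _ := by ring
  · rw [← Real.exp_eq_exp_ℝ, sub_eq_neg_add (Real.exp 1 * ‖x‖), Real.exp_add (-(m : ℝ))]
    refine mul_le_mul_of_nonneg_left ?_ (Real.exp_nonneg _)
    rw [sub_le_self_iff]
    exact Finset.sum_nonneg fun i _ => by positivity

theorem norm_exp_le_exp_norm (x : 𝔸) : ‖NormedSpace.exp x‖ ≤ Real.exp ‖x‖ := by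
  have h1 := NormedSpace.exp_series_hasSum_exp' (𝕂 := ℝ) x
  have h2 := NormedSpace.expSeries_div_hasSum_exp ‖x‖
  rw [← Real.exp_eq_exp_ℝ] at h2
  refine h1.norm_le_of_bounded h2 fun k => ?_
  rw [norm_smul, norm_inv, Real.norm_natCast, div_eq_inv_mul]
  gcongr
  exact norm_pow_le _ _
end

/-! ### Row normalization and the square root of the Gibbs state -/

/-- Rescaling a vector `v` to the length `r` keeps it close to any vector that is close to `v` and
has about this length. -/
theorem norm_rescale_sub_sq_le {E : Type*} [NormedAddCommGroup E] [NormedSpace ℝ E]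
    {v v₀ : E} (hv : v ≠ 0) {r : ℝ} (hr : 0 ≤ r) :
    ‖(r * ‖v‖⁻¹) • v - v₀‖ ^ 2 ≤ 2 * |‖v₀‖ ^ 2 - r ^ 2| + 8 * ‖v - v₀‖ ^ 2 := by
  have hv' : 0 < ‖v‖ := norm_pos_iff.2 hv
  have h1 : ‖(r * ‖v‖⁻¹) • v - v‖ = |r - ‖v‖| := by
    have : (r * ‖v‖⁻¹) • v - v = ((r - ‖v‖) * ‖v‖⁻¹) • v := by
      rw [sub_mul, mul_inv_cancel₀ hv'.ne', sub_smul, one_smul]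
    rw [this, norm_smul, norm_mul, norm_inv, norm_norm, mul_assoc, inv_mul_cancel₀ hv'.ne',
      mul_one, Real.norm_eq_abs]
  have h2 : |r - ‖v‖| ≤ |r - ‖v₀‖| + ‖v - v₀‖ := by
    have := abs_norm_sub_norm_le v₀ v
    rw [norm_sub_rev v₀ v] at this
    calc |r - ‖v‖| = |(r - ‖v₀‖) + (‖v₀‖ - ‖v‖)| := by ring_nf
      _ ≤ _ := (abs_add_le _ _).trans (by linarith)
  have h3 : ‖(r * ‖v‖⁻¹) • v - v₀‖ ≤ |r - ‖v₀‖| + 2 * ‖v - v₀‖ := by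
    have := norm_sub_le_norm_sub_add_norm_sub ((r * ‖v‖⁻¹) • v) v v₀
    linarith
  -- For nonnegative numbers `|r - a| ≤ r + a`. Squared lengths of rows are diagonal entries of the
  -- state, so this is how the `ℓ¹` deviation of the diagonal enters.
  have h4 : |r - ‖v₀‖| ^ 2 ≤ |‖v₀‖ ^ 2 - r ^ 2| := by
    have e : |‖v₀‖ ^ 2 - r ^ 2| = |r - ‖v₀‖| * (r + ‖v₀‖) := by
      rw [← abs_of_nonneg (by positivity : 0 ≤ r + ‖v₀‖), ← abs_mul, abs_sub_comm]; ring_nf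
    rw [e, pow_two]
    gcongr
    rw [abs_le]; constructor <;> linarith [norm_nonneg v₀]
  have h5 := pow_le_pow_left₀ (norm_nonneg _) h3 2
  nlinarith [sq_nonneg (|r - ‖v₀‖| - 2 * ‖v - v₀‖)]

section
variable {ι : Type*} [Fintype ι] [DecidableEq ι]

theorem taylorHalf_eq_sum (H : Matrix ι ι ℝ) (l : ℕ) :
    taylorHalf H l =
      ∑ k ∈ Finset.range (l + 1), ((k.factorial : ℝ)⁻¹) • ((1 / 2 : ℝ) • (-H)) ^ k := by
  refine Finset.sum_congr rfl fun k _ => ?_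
  rw [smul_pow, smul_smul]
  congr 1
  rw [mul_inv, one_div, inv_pow, mul_comm]

/-- The relative error of the truncated Taylor series. -/
theorem norm_taylorHalf_mul_exp_sub_one_le [Nonempty ι] (H : Matrix ι ι ℝ) (l : ℕ) :
    ‖taylorHalf H l * NormedSpace.exp ((1 / 2 : ℝ) • H) - 1‖ ≤
      Real.exp (2 * ‖H‖ - (l + 1 : ℕ)) := by
  have : NormOneClass (Matrix ι ι ℝ) := ⟨CStarRing.norm_one⟩
  have hinv : NormedSpace.exp ((1 / 2 : ℝ) • (-H)) * NormedSpace.exp ((1 / 2 : ℝ) • H) = 1 := by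
    rw [← Matrix.exp_add_of_commute]
    · simp
    · rw [smul_neg]; exact (Commute.refl _).neg_left
  have e : taylorHalf H l * NormedSpace.exp ((1 / 2 : ℝ) • H) - 1
      = -((NormedSpace.exp ((1 / 2 : ℝ) • (-H)) - taylorHalf H l)
        * NormedSpace.exp ((1 / 2 : ℝ) • H)) := by
    rw [sub_mul, hinv]; abel
  have h1 := norm_exp_sub_sum_le_exp ((1 / 2 : ℝ) • (-H)) (l + 1)
  rw [← taylorHalf_eq_sum] at h1
  have h2 := norm_exp_le_exp_norm ((1 / 2 : ℝ) • H)
  rw [e, norm_neg]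
  have h3 : ‖(1 / 2 : ℝ) • (-H)‖ = ‖H‖ / 2 := by
    rw [norm_smul, norm_neg]; norm_num; ring
  have h4 : ‖(1 / 2 : ℝ) • H‖ = ‖H‖ / 2 := by rw [norm_smul]; norm_num; ring
  rw [h3] at h1
  rw [h4] at h2
  refine (norm_mul_le _ _).trans ((mul_le_mul h1 h2 (norm_nonneg _) (Real.exp_nonneg _)).trans ?_)
  rw [← Real.exp_add]
  apply Real.exp_le_exp.2
  -- The exponent is `(e + 1) / 2 * ‖H‖ - (l + 1)`, and `(e + 1) / 2 ≤ 2`.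
  nlinarith [Real.exp_one_lt_d9, norm_nonneg H]

/-- A square root of the Gibbs state. -/
noncomputable def gibbsSqrt (H : Matrix ι ι ℝ) : Matrix ι ι ℝ :=
  (√(NormedSpace.exp (-H)).trace)⁻¹ • NormedSpace.exp ((1 / 2 : ℝ) • (-H))

theorem exp_neg_eq_half_mul_transpose {H : Matrix ι ι ℝ} (hH : H.IsSymm) :
    NormedSpace.exp (-H) =
      NormedSpace.exp ((1 / 2 : ℝ) • (-H)) * (NormedSpace.exp ((1 / 2 : ℝ) • (-H)))ᵀ := by
  rw [← Matrix.exp_transpose, Matrix.transpose_smul, Matrix.transpose_neg, hH.eq,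
    ← Matrix.exp_add_of_commute _ _ (Commute.refl _), ← add_smul]
  norm_num

theorem frobeniusSq_exp_half {H : Matrix ι ι ℝ} (hH : H.IsSymm) :
    frobeniusSq (NormedSpace.exp ((1 / 2 : ℝ) • (-H))) = (NormedSpace.exp (-H)).trace := by
  rw [frobeniusSq_eq_trace, ← exp_neg_eq_half_mul_transpose hH]

theorem gibbsSqrt_mul_transpose {H : Matrix ι ι ℝ} (hH : H.IsSymm) :
    gibbsSqrt H * (gibbsSqrt H)ᵀ = gibbsState H := by
  rw [gibbsSqrt, gibbsState, Matrix.transpose_smul, Matrix.smul_mul, Matrix.mul_smul, smul_smul,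
    ← exp_neg_eq_half_mul_transpose hH, ← mul_inv, Real.mul_self_sqrt]
  rw [← frobeniusSq_exp_half hH]; exact frobeniusSq_nonneg _

theorem frobeniusSq_gibbsSqrt {H : Matrix ι ι ℝ} (hH : H.IsSymm) (h1 : (gibbsState H).trace = 1) :
    frobeniusSq (gibbsSqrt H) = 1 := by
  rw [frobeniusSq_eq_trace, gibbsSqrt_mul_transpose hH, h1]

omit [DecidableEq ι] in
theorem frobeniusSq_smul {κ : Type*} [Fintype κ] (c : ℝ) (M : Matrix ι κ ℝ) :
    frobeniusSq (c • M) = c ^ 2 * frobeniusSq M := by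
  simp [frobeniusSq, Finset.mul_sum, mul_pow]

omit [DecidableEq ι] in
theorem norm_toLp_two_sq (v : ι → ℝ) : ‖WithLp.toLp 2 v‖ ^ 2 = v ⬝ᵥ v := by
  rw [EuclideanSpace.norm_sq_eq]
  exact Finset.sum_congr rfl fun i _ => by rw [Real.norm_eq_abs, sq_abs, pow_two]

omit [DecidableEq ι] in
theorem frobeniusSq_eq_sum_norm_row {κ : Type*} [Fintype κ] (M : Matrix ι κ ℝ) :
    frobeniusSq M = ∑ i, ‖WithLp.toLp 2 (M.row i)‖ ^ 2 := by
  rw [frobeniusSq, Finset.sum_comm]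
  simp [EuclideanSpace.norm_sq_eq, Matrix.row]

/-- Normalizing the rows of the truncated Taylor series gives almost the square root of the Gibbs
state, if its diagonal is almost uniform. -/
theorem exists_unit_rows [Nonempty ι] {H : Matrix ι ι ℝ} (hH : H.IsSymm) {l : ℕ} {δ : ℝ}
    (hδ : ‖taylorHalf H l * NormedSpace.exp ((1 / 2 : ℝ) • H) - 1‖ ≤ δ) (hδ1 : δ < 1)
    (h1 : (gibbsState H).trace = 1) :
    ∃ U : Matrix ι ι ℝ, (∀ a, U a ⬝ᵥ U a = 1) ∧ (∀ a, ∃ c : ℝ, 0 < c ∧ taylorHalf H l a = c • U a) ∧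
      frobeniusSq ((√(Fintype.card ι : ℝ))⁻¹ • U - gibbsSqrt H) ≤
        2 * ∑ i, |gibbsState H i i - 1 / (Fintype.card ι : ℝ)| + 8 * δ ^ 2 := by
  set T := taylorHalf H l with hT
  set B := NormedSpace.exp ((1 / 2 : ℝ) • (-H)) with hB
  set Z := (NormedSpace.exp (-H)).trace with hZ
  have hδ0 : 0 ≤ δ := (norm_nonneg _).trans hδ
  -- As `0⁻¹ = 0`, a vanishing partition function would contradict trace one.
  have hZ0 : Z ≠ 0 := by
    intro h0
    rw [gibbsState, ← hZ, h0, inv_zero, zero_smul, Matrix.trace_zero] at h1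
    exact zero_ne_one h1
  have hZpos : 0 < Z := by
    refine lt_of_le_of_ne ?_ hZ0.symm
    rw [hZ, ← frobeniusSq_exp_half hH]; exact frobeniusSq_nonneg _
  have hinv : NormedSpace.exp ((1 / 2 : ℝ) • H) * B = 1 := by
    rw [hB, ← Matrix.exp_add_of_commute]
    · simp
    · rw [smul_neg]; exact (Commute.refl _).neg_right
  -- A relative error below `1` makes the truncated series invertible, so no row vanishes and
  -- normalization is possible.
  have hunit : IsUnit T := by
    have h2 : IsUnit (T * NormedSpace.exp ((1 / 2 : ℝ) • H)) := by
      have := isUnit_one_sub_of_norm_lt_one (x := 1 - T * NormedSpace.exp ((1 / 2 : ℝ) • H))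
        (by rw [norm_sub_rev]; linarith)
      rwa [sub_sub_cancel] at this
    have h3 := h2.mul (Matrix.isUnit_exp ((1 / 2 : ℝ) • (-H)))
    rwa [mul_assoc, ← hB, hinv, mul_one] at h3
  have hrow : ∀ a, WithLp.toLp 2 (T.row a) ≠ 0 := fun a h0 => by
    have h2 : ∀ j, T a j = 0 := fun j => congrFun (congrArg WithLp.ofLp h0) j
    have h3 := (Matrix.isUnit_iff_isUnit_det T).1 hunit
    rw [Matrix.det_eq_zero_of_row_eq_zero a h2] at h3
    exact not_isUnit_zero h3
  -- The relative error factors out of `T - B`, and `B` has squared Frobenius norm `Z`; dividing by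
  -- `Z` later leaves a bound without any dimension factor.
  have hTB : frobeniusSq (T - B) ≤ δ ^ 2 * Z := by
    have e : T - B = (T * NormedSpace.exp ((1 / 2 : ℝ) • H) - 1) * B := by
      rw [sub_mul, mul_assoc, hinv, mul_one, one_mul]
    rw [e, hZ, ← frobeniusSq_exp_half hH]
    refine (frobeniusSq_mul_le _ _).trans ?_
    have := frobeniusSq_nonneg B
    gcongr
  have hN : (0:ℝ) < Fintype.card ι := by exact_mod_cast Fintype.card_pos
  set U : Matrix ι ι ℝ := fun a => ‖WithLp.toLp 2 (T.row a)‖⁻¹ • T.row a with hU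
  have hUa : ∀ a, U a = ‖WithLp.toLp 2 (T.row a)‖⁻¹ • T.row a := fun a => rfl
  refine ⟨U, fun a => ?_, fun a => ?_, ?_⟩
  · have hpos := norm_pos_iff.2 (hrow a)
    rw [hUa, smul_dotProduct, dotProduct_smul, ← norm_toLp_two_sq, smul_eq_mul, smul_eq_mul]
    field_simp
  · refine ⟨_, norm_pos_iff.2 (hrow a), ?_⟩
    rw [hUa, smul_smul, mul_inv_cancel₀ (norm_ne_zero_iff.2 (hrow a)), one_smul]; rfl
  · set s := (√Z)⁻¹ with hs
    have hspos : 0 < s := inv_pos.2 (Real.sqrt_pos.2 hZpos)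
    have hsZ : s ^ 2 * Z = 1 := by
      rw [hs, inv_pow, Real.sq_sqrt hZpos.le, inv_mul_cancel₀ hZ0]
    have hVV : frobeniusSq (s • T - gibbsSqrt H) ≤ δ ^ 2 := by
      rw [gibbsSqrt, ← hZ, ← hs, ← hB, ← smul_sub, frobeniusSq_smul]
      calc _ ≤ s ^ 2 * (δ ^ 2 * Z) := by gcongr
        _ = δ ^ 2 * (s ^ 2 * Z) := by ring
        _ = _ := by rw [hsZ, mul_one]
    rw [frobeniusSq_eq_sum_norm_row] at hVV ⊢
    calc _ ≤ ∑ i, (2 * |gibbsState H i i - 1 / (Fintype.card ι : ℝ)|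
          + 8 * ‖WithLp.toLp 2 ((s • T - gibbsSqrt H).row i)‖ ^ 2) := by
          refine Finset.sum_le_sum fun i _ => ?_
          -- The row of `s • T` is rescaled to squared length `1 / N`; the target row of `gibbsSqrt
          -- H` has squared length equal to the diagonal entry of the state.
          have hne : s • WithLp.toLp 2 (T.row i) ≠ 0 := smul_ne_zero hspos.ne' (hrow i)
          have h2 := norm_rescale_sub_sq_le (v₀ := WithLp.toLp 2 ((gibbsSqrt H).row i)) hne
            (r := (√(Fintype.card ι : ℝ))⁻¹) (by positivity)
          have e1 : ((√(Fintype.card ι : ℝ))⁻¹ * ‖s • WithLp.toLp 2 (T.row i)‖⁻¹) •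
              s • WithLp.toLp 2 (T.row i) = WithLp.toLp 2
              ((√(Fintype.card ι : ℝ))⁻¹ • (‖WithLp.toLp 2 (T.row i)‖⁻¹ • T.row i)) := by
            rw [norm_smul, Real.norm_of_nonneg hspos.le, smul_smul, WithLp.toLp_smul,
              WithLp.toLp_smul, smul_smul]
            congr 1
            field_simp
          have e2 : ‖WithLp.toLp 2 ((gibbsSqrt H).row i)‖ ^ 2 = gibbsState H i i := by
            rw [← gibbsSqrt_mul_transpose hH, norm_toLp_two_sq]; rfl
          have e3 : ((√(Fintype.card ι : ℝ))⁻¹) ^ 2 = 1 / (Fintype.card ι : ℝ) := by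
            rw [inv_pow, Real.sq_sqrt hN.le, one_div]
          rw [e1, e2, e3] at h2
          exact h2
      _ = 2 * ∑ i, |gibbsState H i i - 1 / (Fintype.card ι : ℝ)|
          + 8 * ∑ i, ‖WithLp.toLp 2 ((s • T - gibbsSqrt H).row i)‖ ^ 2 := by
          rw [Finset.sum_add_distrib, Finset.mul_sum, Finset.mul_sum]
      _ ≤ _ := by gcongr
end

/-! ### Entrywise pairing and block matrices -/

/-- The entrywise inner product of two matrices. -/
def entrywiseInner {ι κ : Type*} [Fintype ι] [Fintype κ] (A M : Matrix ι κ ℝ) : ℝ :=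
  ∑ i, ∑ j, A i j * M i j

section
variable {ι κ : Type*} [Fintype ι] [Fintype κ]

theorem entrywiseInner_add (A M N : Matrix ι κ ℝ) :
    entrywiseInner A (M + N) = entrywiseInner A M + entrywiseInner A N := by
  simp [entrywiseInner, mul_add, Finset.sum_add_distrib]

theorem entrywiseInner_smul (A M : Matrix ι κ ℝ) (c : ℝ) :
    entrywiseInner A (c • M) = c * entrywiseInner A M := by
  simp only [entrywiseInner, Matrix.smul_apply, smul_eq_mul, Finset.mul_sum]
  exact Finset.sum_congr rfl fun i _ => Finset.sum_congr rfl fun j _ => by ring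

theorem entrywiseInner_sub (A M N : Matrix ι κ ℝ) :
    entrywiseInner A (M - N) = entrywiseInner A M - entrywiseInner A N := by
  simp [entrywiseInner, mul_sub, Finset.sum_sub_distrib]

theorem entrywiseInner_neg (A M : Matrix ι κ ℝ) :
    entrywiseInner A (-M) = -entrywiseInner A M := by
  simp [entrywiseInner]

theorem entrywiseInner_sub_left (A B M : Matrix ι κ ℝ) :
    entrywiseInner (A - B) M = entrywiseInner A M - entrywiseInner B M := by
  simp [entrywiseInner, sub_mul, Finset.sum_sub_distrib]

theorem entrywiseInner_diagonal [DecidableEq ι] (w : ι → ℝ) (M : Matrix ι ι ℝ) :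
    entrywiseInner (Matrix.diagonal w) M = ∑ i, w i * M i i := by
  simp [entrywiseInner, Matrix.diagonal_apply, ite_mul]

theorem entrywiseInner_transpose (A M : Matrix ι ι ℝ) :
    entrywiseInner Aᵀ Mᵀ = entrywiseInner A M := by
  simp only [entrywiseInner, Matrix.transpose_apply]; exact Finset.sum_comm

theorem trace_mul_eq_entrywiseInner (A M : Matrix ι ι ℝ) :
    (A * M).trace = entrywiseInner A Mᵀ := by
  simp [entrywiseInner, Matrix.trace, Matrix.mul_apply]

omit [Fintype ι] in
theorem Matrix.PosSemidef.transpose_eq {M : Matrix ι ι ℝ} (hM : M.PosSemidef) : Mᵀ = M := by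
  rw [← Matrix.conjTranspose_eq_transpose_of_trivial]; exact hM.isHermitian

theorem Matrix.PosSemidef.entrywiseInner_nonneg {A M : Matrix ι ι ℝ} (hA : A.PosSemidef)
    (hM : M.PosSemidef) : 0 ≤ entrywiseInner A M := by
  have := hA.trace_mul_nonneg hM
  rwa [trace_mul_eq_entrywiseInner, hM.transpose_eq] at this

/-- The compression of a block matrix to the vectors `(c, s • c)`. -/
theorem Matrix.PosSemidef.compress {M : Matrix (ι ⊕ ι) (ι ⊕ ι) ℝ} (hM : M.PosSemidef) (s : ℝ) :
    (M.toBlocks₁₁ + s • (M.toBlocks₁₂ + M.toBlocks₂₁) + (s * s) • M.toBlocks₂₂).PosSemidef := by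
  refine Matrix.PosSemidef.of_dotProduct_mulVec_nonneg ?_ fun c => ?_
  · have hs : ∀ a b, M b a = M a b := fun a b => congrFun (congrFun hM.transpose_eq a) b
    ext i j
    simp [Matrix.toBlocks₁₁, Matrix.toBlocks₁₂, Matrix.toBlocks₂₁, Matrix.toBlocks₂₂, hs (.inl i),
      hs (.inr i)]
    ring
  · have h := hM.dotProduct_mulVec_nonneg (Sum.elim c (s • c))
    convert h using 1
    simp only [dotProduct, Matrix.mulVec, Fintype.sum_sum_type, Matrix.add_apply,
      Matrix.smul_apply, star_trivial, Sum.elim_inl, Sum.elim_inr, Pi.smul_apply, smul_eq_mul,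
      Matrix.toBlocks₁₁, Matrix.toBlocks₁₂, Matrix.toBlocks₂₁, Matrix.toBlocks₂₂, Matrix.of_apply,
      ← Finset.sum_add_distrib, Finset.mul_sum]
    exact Finset.sum_congr rfl fun i _ => Finset.sum_congr rfl fun j _ => by ring

end

/-! ### From sign correlations to the objective value -/

section
variable {n : ℕ}

theorem sdpObjective_bipartiteMatrix (A : Matrix (Fin n) (Fin n) ℝ)
    {X : Matrix (Fin n ⊕ Fin n) (Fin n ⊕ Fin n) ℝ} (hX : X.PosSemidef) :
    sdpObjective (bipartiteMatrix A) X = ‖A‖⁻¹ * (2 * entrywiseInner A X.toBlocks₁₂) := by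
  have hs : ∀ a b, X b a = X a b := fun a b => congrFun (congrFun hX.transpose_eq a) b
  rw [sdpObjective, norm_bipartiteMatrix, Matrix.smul_mul, Matrix.trace_smul, smul_eq_mul]
  congr 1
  rw [two_mul]
  simp only [Matrix.trace, Matrix.diag, Matrix.mul_apply, Fintype.sum_sum_type, bipartiteMatrix,
    Matrix.fromBlocks_apply₁₁, Matrix.fromBlocks_apply₁₂, Matrix.fromBlocks_apply₂₁,
    Matrix.fromBlocks_apply₂₂, Matrix.zero_apply, zero_mul, Finset.sum_const_zero, zero_add,
    add_zero, Matrix.transpose_apply, entrywiseInner, Matrix.toBlocks₁₂, Matrix.of_apply]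
  congr 1
  · exact Finset.sum_congr rfl fun i _ => Finset.sum_congr rfl fun j _ => by rw [hs]
  · exact Finset.sum_comm

theorem entrywiseInner_eq_sdpObjective (hn : 1 ≤ n) (A : Matrix (Fin n) (Fin n) ℝ)
    {G : Matrix (Fin n ⊕ Fin n) (Fin n ⊕ Fin n) ℝ} (hG : G.PosSemidef) :
    entrywiseInner A G.toBlocks₁₂ = n * ‖A‖ *
      sdpObjective (bipartiteMatrix A) ((1 / (Fintype.card (Fin n ⊕ Fin n) : ℝ)) • G) := by
  have hn' : (0 : ℝ) < n := by exact_mod_cast hn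
  rw [sdpObjective_bipartiteMatrix A (hG.smul (by positivity))]
  have e : ((1 / (Fintype.card (Fin n ⊕ Fin n) : ℝ)) • G).toBlocks₁₂
      = (1 / (2 * n : ℝ)) • G.toBlocks₁₂ := by
    rw [Fintype.card_sum, Fintype.card_fin]
    ext i j; simp [Matrix.toBlocks₁₂, two_mul]
  rw [e, entrywiseInner_smul]
  -- Cancelling `‖A‖` against its inverse fails for `A = 0`, where both sides vanish.
  by_cases hA : ‖A‖ = 0
  · have : A = 0 := norm_eq_zero.1 hA
    subst this
    simp [entrywiseInner]
  · field_simp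

theorem IsCorrelation.isSDPFeasible (hn : 1 ≤ n)
    {G : Matrix (Fin n ⊕ Fin n) (Fin n ⊕ Fin n) ℝ} (hG : IsCorrelation G) :
    IsSDPFeasible ((1 / (Fintype.card (Fin n ⊕ Fin n) : ℝ)) • G) := by
  refine ⟨hG.1.smul (by positivity), ?_, fun i => by simp [hG.2]⟩
  have hn' : (0 : ℝ) < n := by exact_mod_cast hn
  simp only [Matrix.trace, Matrix.diag, Matrix.smul_apply, hG.2]
  simp
  field_simp

/-- Flipping the signs of the second half of a psd matrix. -/
theorem Matrix.PosSemidef.flip {M : Matrix (Fin n ⊕ Fin n) (Fin n ⊕ Fin n) ℝ} (hM : M.PosSemidef) :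
    (Matrix.fromBlocks M.toBlocks₁₁ (-M.toBlocks₁₂) (-M.toBlocks₂₁) M.toBlocks₂₂).PosSemidef := by
  have h := hM.mul_mul_conjTranspose_same
    (Matrix.diagonal (Sum.elim (fun _ => 1) (fun _ => -1) : Fin n ⊕ Fin n → ℝ))
  convert h using 1
  ext (i | i) (j | j) <;> simp [Matrix.diagonal_mul, Matrix.mul_diagonal, Matrix.toBlocks₁₁,
    Matrix.toBlocks₁₂, Matrix.toBlocks₂₁, Matrix.toBlocks₂₂]

/-- The lower bound for the signs, for any matrix `A`. -/
theorem entrywiseInner_sign_ge {A : Matrix (Fin n) (Fin n) ℝ}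
    {X G : Matrix (Fin n ⊕ Fin n) (Fin n ⊕ Fin n) ℝ} (hX : ∀ a, X a a = 1) (hG : ∀ a, G a a = 1)
    (hP : (X - (2 / Real.pi) • G).PosSemidef) {b : ℝ}
    (hopt : ∀ M : Matrix (Fin n ⊕ Fin n) (Fin n ⊕ Fin n) ℝ, IsCorrelation M →
      entrywiseInner A M.toBlocks₁₂ ≤ b) :
    2 / Real.pi * entrywiseInner A G.toBlocks₁₂ - (1 - 2 / Real.pi) * b ≤
      entrywiseInner A X.toBlocks₁₂ := by
  have hk : 0 < 1 - 2 / Real.pi := by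
    rw [sub_pos, div_lt_one Real.pi_pos]; linarith [Real.pi_gt_three]
  set k := 1 - 2 / Real.pi with hkdef
  -- The flip turns the upper bound `b` into a lower bound for the pairing of `A` with the remainder
  -- `X - (2 / π) G`, whose diagonal is `k`.
  have h := hopt (k⁻¹ • _) ⟨hP.flip.smul (inv_nonneg.2 hk.le), fun a => ?_⟩
  · have e : (k⁻¹ • Matrix.fromBlocks (X - (2 / Real.pi) • G).toBlocks₁₁
        (-(X - (2 / Real.pi) • G).toBlocks₁₂) (-(X - (2 / Real.pi) • G).toBlocks₂₁)
        (X - (2 / Real.pi) • G).toBlocks₂₂).toBlocks₁₂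
        = k⁻¹ • -(X.toBlocks₁₂ - (2 / Real.pi) • G.toBlocks₁₂) := by
      ext i j; simp [Matrix.toBlocks₁₂]
    rw [e, entrywiseInner_smul, entrywiseInner_neg, entrywiseInner_sub, entrywiseInner_smul,
      inv_mul_le_iff₀ hk] at h
    linarith
  · rcases a with a | a <;>
      simp [Matrix.toBlocks₁₁, Matrix.toBlocks₂₂, hX, hG, hk.ne', ← hkdef]

theorem entrywiseInner_compress {A : Matrix (Fin n) (Fin n) ℝ} (hA : A.PosSemidef)
    {M : Matrix (Fin n ⊕ Fin n) (Fin n ⊕ Fin n) ℝ} (hM : M.PosSemidef) (s : ℝ) :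
    entrywiseInner A
      (M.toBlocks₁₁ + s • (M.toBlocks₁₂ + M.toBlocks₂₁) + (s * s) • M.toBlocks₂₂) =
    entrywiseInner A M.toBlocks₁₁ + 2 * s * entrywiseInner A M.toBlocks₁₂
      + s * s * entrywiseInner A M.toBlocks₂₂ := by
  have h21 : M.toBlocks₂₁ = M.toBlocks₁₂ᵀ := by
    ext i j; exact congrFun (congrFun hM.transpose_eq (.inr i)) (.inl j) |>.symm
  have h : entrywiseInner A M.toBlocks₂₁ = entrywiseInner A M.toBlocks₁₂ := by
    rw [h21, ← entrywiseInner_transpose A, hA.transpose_eq, Matrix.transpose_transpose]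
  rw [entrywiseInner_add, entrywiseInner_add, entrywiseInner_smul, entrywiseInner_smul,
    entrywiseInner_add, h]
  ring

/-- The lower bound for the signs, for psd matrices `A`. -/
theorem entrywiseInner_sign_ge_of_posSemidef {A : Matrix (Fin n) (Fin n) ℝ} (hA : A.PosSemidef)
    {X G : Matrix (Fin n ⊕ Fin n) (Fin n ⊕ Fin n) ℝ} (hX : IsCorrelation X) (hG : IsCorrelation G)
    (hP : (X - (2 / Real.pi) • G).PosSemidef) {b ε : ℝ} (hε : 0 < ε)
    (hclose : ∀ i : Fin n, 2 - 2 * X (.inl i) (.inr i) ≤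
      4 * ε + (2 - 2 * G (.inl i) (.inr i)) / ε)
    (hopt : ∀ M : Matrix (Fin n ⊕ Fin n) (Fin n ⊕ Fin n) ℝ, IsCorrelation M →
      entrywiseInner A M.toBlocks₁₂ ≤ b) :
    2 / Real.pi * entrywiseInner A G.toBlocks₁₂
        - (2 * ε * b + 2 * (b - entrywiseInner A G.toBlocks₁₂) / ε) ≤
      entrywiseInner A X.toBlocks₁₂ := by
  have hAs : A.IsSymm := hA.transpose_eq
  obtain ⟨G₀, w, hG₀, hw, hdual⟩ := exists_dual_optimal hAs
  have hS : ∑ i, w i ≤ b := by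
    -- Copying `G₀` into all four blocks corresponds to `x = y`, so the SDP value of `A` itself is
    -- at most `b`.
    have h := hopt (G₀.submatrix (Sum.elim id id) (Sum.elim id id))
      ⟨hG₀.1.submatrix _, fun a => hG₀.2 _⟩
    rw [hw, trace_mul_eq_entrywiseInner, hG₀.1.transpose_eq]
    exact h
  have hw0 : ∀ i, 0 ≤ w i := fun i => by
    have h1 := hdual.diag_nonneg (i := i)
    have h2 := hA.diag_nonneg (i := i)
    simp at h1
    linarith
  have hsymm : ∀ {M : Matrix (Fin n ⊕ Fin n) (Fin n ⊕ Fin n) ℝ}, M.PosSemidef → ∀ i j,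
      M (.inr j) (.inl i) = M (.inl i) (.inr j) := fun hM i j =>
    congrFun (congrFun hM.transpose_eq (.inl i)) (.inr j)
  have hdiag : ∀ {M : Matrix (Fin n ⊕ Fin n) (Fin n ⊕ Fin n) ℝ}, IsCorrelation M → ∀ s : ℝ,
      s * s = 1 → entrywiseInner (Matrix.diagonal w)
      (M.toBlocks₁₁ + s • (M.toBlocks₁₂ + M.toBlocks₂₁) + (s * s) • M.toBlocks₂₂)
      = ∑ i, w i * (2 + 2 * s * M (.inl i) (.inr i)) := fun hM s hs => by
    rw [entrywiseInner_diagonal]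
    refine Finset.sum_congr rfl fun i _ => ?_
    simp [Matrix.toBlocks₁₁, Matrix.toBlocks₁₂, Matrix.toBlocks₂₁, Matrix.toBlocks₂₂, hM.2, hs,
      hsymm hM.1]
    left; ring
  -- With `u i`, `v i` the unit vectors behind `G`, `h1` bounds `∑ w i * ‖u i + v i‖ ^ 2` from below
  -- by `⟨A, G₁₁⟩ + 2 g + ⟨A, G₂₂⟩`, and `h2` shows that this is at least `4 g`. By the
  -- parallelogram law `∑ w i * ‖u i - v i‖ ^ 2 ≤ 4 (b - g)`, which is `h7`.
  have h1 := hdual.entrywiseInner_nonneg (hG.1.compress 1)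
  rw [entrywiseInner_sub_left, hdiag hG 1 (by norm_num), entrywiseInner_compress hA hG.1] at h1
  have h2 := hA.entrywiseInner_nonneg (hG.1.compress (-1))
  rw [entrywiseInner_compress hA hG.1] at h2
  -- The dual bound for `E ⟨x - y, A (x - y)⟩`; expanding the left side isolates the off-diagonal
  -- block of `X`.
  have h3 := hdual.entrywiseInner_nonneg (hX.1.compress (-1))
  rw [entrywiseInner_sub_left, hdiag hX (-1) (by norm_num), entrywiseInner_compress hA hX.1] at h3
  have h4 := hA.entrywiseInner_nonneg (hP.submatrix Sum.inl)
  have e4 : (X - (2 / Real.pi) • G).submatrix Sum.inl Sum.inl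
      = X.toBlocks₁₁ - (2 / Real.pi) • G.toBlocks₁₁ := rfl
  rw [e4, entrywiseInner_sub, entrywiseInner_smul] at h4
  have h5 := hA.entrywiseInner_nonneg (hP.submatrix Sum.inr)
  have e5 : (X - (2 / Real.pi) • G).submatrix Sum.inr Sum.inr
      = X.toBlocks₂₂ - (2 / Real.pi) • G.toBlocks₂₂ := rfl
  rw [e5, entrywiseInner_sub, entrywiseInner_smul] at h5
  set g := entrywiseInner A G.toBlocks₁₂
  have h6 : ∑ i, w i * (2 + 2 * 1 * G (.inl i) (.inr i))
      = 4 * ∑ i, w i - ∑ i, w i * (2 - 2 * G (.inl i) (.inr i)) := by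
    rw [Finset.mul_sum, ← Finset.sum_sub_distrib]
    exact Finset.sum_congr rfl fun i _ => by ring
  have h7 : ∑ i, w i * (2 - 2 * G (.inl i) (.inr i)) ≤ 4 * (b - g) := by linarith
  have h8 : ∑ i, w i * (2 + 2 * (-1) * X (.inl i) (.inr i)) ≤
      4 * ε * b + 4 * (b - g) / ε := by
    calc _ ≤ ∑ i, w i * (4 * ε + (2 - 2 * G (.inl i) (.inr i)) / ε) := by
          refine Finset.sum_le_sum fun i _ => mul_le_mul_of_nonneg_left ?_ (hw0 i)
          linarith [hclose i]
      _ = 4 * ε * ∑ i, w i + (∑ i, w i * (2 - 2 * G (.inl i) (.inr i))) / ε := by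
          rw [Finset.mul_sum, Finset.sum_div, ← Finset.sum_add_distrib]
          exact Finset.sum_congr rfl fun i _ => by ring
      _ ≤ _ := by gcongr
  have hpi : 0 ≤ 2 / Real.pi := by positivity
  have h9 : 2 / Real.pi * (2 * g) ≤
      2 / Real.pi * (entrywiseInner A G.toBlocks₁₁ + entrywiseInner A G.toBlocks₂₂) := by
    gcongr; linarith
  have e : 2 * (b - g) / ε = 4 * (b - g) / ε / 2 := by ring
  rw [e]
  rw [mul_add] at h9
  generalize 4 * (b - g) / ε = r at *
  generalize 2 / Real.pi = p at *
  linarith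
end

/-! ### Expected value of the rounding procedure -/

instance : IsProbabilityMeasure gaussianSequence := by
  unfold gaussianSequence; infer_instance

section
variable {n : ℕ}

theorem hasLaw_gaussianVector (i : Fin n ⊕ Fin n) :
    HasLaw (fun ω => gaussianVector n ω i) (gaussianReal 0 1) gaussianSequence :=
  (measurePreserving_eval_infinitePi (fun _ : ℕ => gaussianReal 0 1) _).hasLaw

theorem iIndepFun_gaussianVector :
    iIndepFun (fun (i : Fin n ⊕ Fin n) ω => gaussianVector n ω i) gaussianSequence := by
  have h := iIndepFun_infinitePi (P := fun _ : ℕ => gaussianReal 0 1) (X := fun _ x => x)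
    (fun _ => measurable_id)
  exact h.precomp (g := fun i : Fin n ⊕ Fin n => (finSumFinEquiv i).val)
    (Fin.val_injective.comp finSumFinEquiv.injective)

theorem isSignVector_round (H : Matrix (Fin n ⊕ Fin n) (Fin n ⊕ Fin n) ℝ) (l : ℕ) (ω : ℕ → ℝ) :
    IsSignVector (roundX H l ω) ∧ IsSignVector (roundY H l ω) :=
  ⟨fun _ => signPM_eq_or _, fun _ => signPM_eq_or _⟩

/-- The correlation matrix of the rounded signs. -/
noncomputable def roundCorrelation (H : Matrix (Fin n ⊕ Fin n) (Fin n ⊕ Fin n) ℝ) (l : ℕ) :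
    Matrix (Fin n ⊕ Fin n) (Fin n ⊕ Fin n) ℝ :=
  signCorrelation gaussianSequence (fun i ω => gaussianVector n ω i) (taylorHalf H l)

theorem isCorrelation_roundCorrelation (H : Matrix (Fin n ⊕ Fin n) (Fin n ⊕ Fin n) ℝ) (l : ℕ) :
    IsCorrelation (roundCorrelation H l) :=
  ⟨signCorrelation_posSemidef hasLaw_gaussianVector _, signCorrelation_diag _⟩

theorem dotProduct_mulVec_eq_sum (A : Matrix (Fin n) (Fin n) ℝ) (x y : Fin n → ℝ) :
    x ⬝ᵥ (A *ᵥ y) = ∑ i, ∑ j, A i j * (x i * y j) := by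
  simp only [dotProduct, Matrix.mulVec, Finset.mul_sum]
  exact Finset.sum_congr rfl fun i _ => Finset.sum_congr rfl fun j _ => by ring

theorem integrable_roundX_mul_roundY (H : Matrix (Fin n ⊕ Fin n) (Fin n ⊕ Fin n) ℝ) (l : ℕ)
    (i j : Fin n) : Integrable (fun ω => roundX H l ω i * roundY H l ω j) gaussianSequence :=
  integrable_signPM_mul_signPM hasLaw_gaussianVector (taylorHalf H l (.inl i))
    (taylorHalf H l (.inr j))

theorem integrable_round (A : Matrix (Fin n) (Fin n) ℝ)
    (H : Matrix (Fin n ⊕ Fin n) (Fin n ⊕ Fin n) ℝ) (l : ℕ) :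
    Integrable (fun ω => roundX H l ω ⬝ᵥ (A *ᵥ roundY H l ω)) gaussianSequence := by
  simp_rw [dotProduct_mulVec_eq_sum]
  exact integrable_finsetSum _ fun i _ => integrable_finsetSum _ fun j _ =>
    (integrable_roundX_mul_roundY H l i j).const_mul _

theorem integral_round (A : Matrix (Fin n) (Fin n) ℝ)
    (H : Matrix (Fin n ⊕ Fin n) (Fin n ⊕ Fin n) ℝ) (l : ℕ) :
    ∫ ω, roundX H l ω ⬝ᵥ (A *ᵥ roundY H l ω) ∂gaussianSequence =
      entrywiseInner A (roundCorrelation H l).toBlocks₁₂ := by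
  simp_rw [dotProduct_mulVec_eq_sum]
  refine (integral_finsetSum _ fun i _ => integrable_finsetSum _ fun j _ =>
    (integrable_roundX_mul_roundY H l i j).const_mul _).trans
    (Finset.sum_congr rfl fun i _ => ?_)
  refine (integral_finsetSum _ fun j _ => (integrable_roundX_mul_roundY H l i j).const_mul _).trans
    (Finset.sum_congr rfl fun j _ => ?_)
  rw [integral_const_mul]
  rfl

theorem IsSignVector.norm_sq {x : Fin n → ℝ} (hx : IsSignVector x) :
    ‖WithLp.toLp 2 x‖ ^ 2 = n := by
  rw [norm_toLp_two_sq, dotProduct]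
  have : ∀ i, x i * x i = 1 := fun i => by rcases hx i with h | h <;> rw [h] <;> norm_num
  simp [this]

theorem IsSignVector.abs_dotProduct_mulVec_le {x y : Fin n → ℝ} (hx : IsSignVector x)
    (hy : IsSignVector y) (A : Matrix (Fin n) (Fin n) ℝ) : |x ⬝ᵥ (A *ᵥ y)| ≤ n * ‖A‖ := by
  have h1 : x ⬝ᵥ (A *ᵥ y) = inner ℝ (WithLp.toLp 2 (A *ᵥ y)) (WithLp.toLp 2 x) := by
    simp [PiLp.inner_apply, dotProduct]
  have h2 := Matrix.l2_opNorm_mulVec A (WithLp.toLp 2 y)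
  have hxy : ‖WithLp.toLp 2 y‖ * ‖WithLp.toLp 2 x‖ = n := by
    have e : ‖WithLp.toLp 2 y‖ = ‖WithLp.toLp 2 x‖ := by
      rw [← sq_eq_sq₀ (norm_nonneg _) (norm_nonneg _), hx.norm_sq, hy.norm_sq]
    rw [e, ← pow_two, hx.norm_sq]
  rw [h1]
  refine (abs_real_inner_le_norm _ _).trans ?_
  calc _ ≤ ‖A‖ * ‖WithLp.toLp 2 y‖ * ‖WithLp.toLp 2 x‖ := by gcongr; exact h2
    _ = n * ‖A‖ := by rw [mul_assoc, hxy, mul_comm]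

theorem IsSignVector.le_inftyOneNorm {x y : Fin n → ℝ} (hx : IsSignVector x)
    (hy : IsSignVector y) (A : Matrix (Fin n) (Fin n) ℝ) : x ⬝ᵥ (A *ᵥ y) ≤ inftyOneNorm A := by
  refine le_csSup ⟨n * ‖A‖, ?_⟩ ⟨x, y, hx, hy, rfl⟩
  rintro _ ⟨x, y, hx, hy, rfl⟩
  exact (le_abs_self _).trans (hx.abs_dotProduct_mulVec_le hy A)

theorem inftyOneNorm_le {A : Matrix (Fin n) (Fin n) ℝ} {b : ℝ}
    (h : ∀ x y : Fin n → ℝ, IsSignVector x → IsSignVector y → x ⬝ᵥ (A *ᵥ y) ≤ b) :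
    inftyOneNorm A ≤ b := by
  refine csSup_le ⟨_, 1, 1, fun _ => .inl rfl, fun _ => .inl rfl, rfl⟩ ?_
  rintro _ ⟨x, y, hx, hy, rfl⟩
  exact h x y hx hy

theorem IsSignVector.isCorrelation {ι : Type*} [Fintype ι] {z : ι → ℝ} (hz : IsSignVector z) :
    IsCorrelation (Matrix.vecMulVec z z) := by
  refine ⟨Matrix.posSemidef_vecMulVec_self_star z, fun i => ?_⟩
  rw [Matrix.vecMulVec_apply]
  rcases hz i with h | h <;> rw [h] <;> norm_num

theorem inftyOneNorm_le_of_correlation {A : Matrix (Fin n) (Fin n) ℝ} {b : ℝ}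
    (hopt : ∀ M : Matrix (Fin n ⊕ Fin n) (Fin n ⊕ Fin n) ℝ, IsCorrelation M →
      entrywiseInner A M.toBlocks₁₂ ≤ b) : inftyOneNorm A ≤ b := by
  refine inftyOneNorm_le fun x y hx hy => ?_
  have hz : IsSignVector (Sum.elim x y) := by
    rintro (i | i)
    · exact hx i
    · exact hy i
  have h := hopt _ hz.isCorrelation
  rw [dotProduct_mulVec_eq_sum]
  exact h

theorem IsApproxSDPSolution.entrywiseInner_le (hn : 1 ≤ n) {A : Matrix (Fin n) (Fin n) ℝ}
    {δ : ℝ} {ρ : Matrix (Fin n ⊕ Fin n) (Fin n ⊕ Fin n) ℝ}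
    (h : IsApproxSDPSolution (bipartiteMatrix A) δ ρ)
    {M : Matrix (Fin n ⊕ Fin n) (Fin n ⊕ Fin n) ℝ} (hM : IsCorrelation M) :
    entrywiseInner A M.toBlocks₁₂ ≤ n * ‖A‖ * (sdpObjective (bipartiteMatrix A) ρ + δ) := by
  rw [entrywiseInner_eq_sdpObjective hn A hM.1]
  exact mul_le_mul_of_nonneg_left (h.2.2.2 _ (hM.isSDPFeasible hn)) (by positivity)

/-- Signs do not see positive scalings, so the unnormalized rows that the program uses may be
replaced by unit vectors in the analysis. -/
theorem signCorrelation_of_rows {Ω ι κ : Type*} [MeasurableSpace Ω] [Fintype ι] (P : Measure Ω)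
    (g : ι → Ω → ℝ) {T U : Matrix κ ι ℝ} (h : ∀ a, ∃ c : ℝ, 0 < c ∧ T a = c • U a) :
    signCorrelation P g T = signCorrelation P g U := by
  have hs : ∀ a ω, signPM (∑ i, T a i * g i ω) = signPM (∑ i, U a i * g i ω) := fun a ω => by
    obtain ⟨c, hc, e⟩ := h a
    have : ∀ i, T a i = c * U a i := fun i => congrFun e i
    simp_rw [this, mul_assoc, ← Finset.mul_sum]
    exact signPM_mul_of_pos hc _
  ext a b
  simp [signCorrelation, hs]

theorem abs_sdpObjective_gram_sub_le {ι : Type*} [Fintype ι] [DecidableEq ι] (M : Matrix ι ι ℝ)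
    {U V : Matrix ι ι ℝ} (hU : frobeniusSq U = 1) (hV : frobeniusSq V = 1) :
    |sdpObjective M (U * Uᵀ) - sdpObjective M (V * Vᵀ)| ≤ 2 * √(frobeniusSq (U - V)) := by
  have h := abs_trace_mul_gram_sub_le M hU hV
  simp only [sdpObjective, Matrix.smul_mul, Matrix.trace_smul, smul_eq_mul]
  rw [← mul_sub, abs_mul, abs_of_nonneg (by positivity : 0 ≤ ‖M‖⁻¹)]
  calc _ ≤ ‖M‖⁻¹ * (‖M‖ * (2 * √(frobeniusSq (U - V)))) := by gcongr
    _ = (‖M‖⁻¹ * ‖M‖) * (2 * √(frobeniusSq (U - V))) := by ring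
    _ ≤ 1 * _ := by gcongr; exact inv_mul_le_one
    _ = _ := one_mul _

theorem abs_sdpObjective_gram_le {ι : Type*} [Fintype ι] [DecidableEq ι] (M : Matrix ι ι ℝ)
    {U : Matrix ι ι ℝ} (hU : frobeniusSq U = 1) : |sdpObjective M (U * Uᵀ)| ≤ 1 := by
  have h := abs_trace_mul_gram_le M hU
  simp only [sdpObjective, Matrix.smul_mul, Matrix.trace_smul, smul_eq_mul]
  rw [abs_mul, abs_of_nonneg (by positivity : 0 ≤ ‖M‖⁻¹)]
  calc _ ≤ ‖M‖⁻¹ * ‖M‖ := by gcongr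
    _ ≤ 1 := inv_mul_le_one

/-- Apply `exp x ≥ x ^ 2 / 2` at `x = 4 * 0.69 / ε`, where `2 / 2.76 ^ 2 < 3 / 10`. -/
theorem exp_neg_le_sq {q ε : ℝ} (hε : 0 < ε) (hq : Real.log 2 / ε ≤ q) :
    Real.exp (-(4 * q)) ≤ 3 / 10 * ε ^ 2 := by
  have hl := Real.log_two_gt_d9
  have hq0 : 0.69 / ε ≤ q := le_trans (by gcongr; linarith) hq
  have h1 : (4 * (0.69 / ε)) ^ 2 / 2 ≤ Real.exp (4 * q) := by
    have h2 : (0:ℝ) ≤ 4 * (0.69 / ε) := by positivity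
    refine le_trans ?_ (Real.exp_le_exp.2 (mul_le_mul_of_nonneg_left hq0 (by norm_num)))
    linarith [Real.quadratic_le_exp_of_nonneg h2]
  rw [Real.exp_neg]
  refine (inv_anti₀ (by positivity) h1).trans ?_
  have : ((4 * (0.69 / ε)) ^ 2 / 2)⁻¹ = (2 / (4 * 0.69) ^ 2) * ε ^ 2 := by field_simp
  rw [this]
  exact mul_le_mul_of_nonneg_right (by norm_num) (sq_nonneg ε)

theorem two_div_pi_bounds : 5 / 8 < 2 / Real.pi ∧ 2 / Real.pi < 2 / 3 := by
  constructor
  · rw [div_lt_div_iff₀ (by norm_num) Real.pi_pos]; linarith [Real.pi_lt_d2]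
  · exact div_lt_div_of_pos_left (by norm_num) (by norm_num) Real.pi_gt_three

theorem roundingConst_ge (A : Matrix (Fin n) (Fin n) ℝ) : 1 / 4 ≤ roundingConst A := by
  have h := two_div_pi_bounds
  have e : 4 / Real.pi = 2 * (2 / Real.pi) := by ring
  unfold roundingConst
  split_ifs <;> linarith

/-- In units of `m * ε`, the losses are at most `4` from `v`, `4` from the threshold term and `10`
from the quotient, while `40 p ≥ 25` is available. -/
theorem rounding_arith_of_posSemidef {p m α ε v : ℝ} (hp : 5 / 8 < p) (hp' : p < 2 / 3) (hm : 0 ≤ m)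
    (hε : 0 < ε) (hε1 : ε < 1) (hα : α ≤ 1) (hv : m * (α - 4 * ε ^ 2) ≤ v) :
    p * (m * (α - 40 * ε)) ≤
      p * v - (2 * ε * (m * (α + ε ^ 4)) + 2 * (m * (α + ε ^ 4) - v) / ε) := by
  have hε2 : ε ^ 2 ≤ ε := by nlinarith
  have hε4 : ε ^ 4 ≤ ε ^ 2 := pow_le_pow_of_le_one hε.le hε1.le (by norm_num)
  have hmε : 0 ≤ m * ε := by positivity
  have hmε2 : m * ε ^ 2 ≤ m * ε := by gcongr
  have hmε4 : m * ε ^ 4 ≤ m * ε ^ 2 := by gcongr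
  have hmε20 : 0 ≤ m * ε ^ 2 := by positivity
  have h1 : m * ε * (α + ε ^ 4) ≤ m * ε * 2 := mul_le_mul_of_nonneg_left (by linarith) hmε
  have h2 : (m * (α + ε ^ 4) - v) / ε ≤ 5 * (m * ε) := by
    rw [div_le_iff₀ hε]
    linarith
  have h3 : p * (m * (α - 4 * ε ^ 2)) ≤ p * v := mul_le_mul_of_nonneg_left hv (by linarith)
  have h4 : p * (m * ε ^ 2) ≤ 1 * (m * ε ^ 2) := mul_le_mul_of_nonneg_right (by linarith) hmε20
  have h5 : 5 / 8 * (m * ε) ≤ p * (m * ε) := mul_le_mul_of_nonneg_right hp.le hmε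
  have e1 : 2 * (m * (α + ε ^ 4) - v) / ε = 2 * ((m * (α + ε ^ 4) - v) / ε) := by ring
  rw [e1]
  linarith

theorem rounding_arith {p m α ε v : ℝ} (hp : 5 / 8 < p) (hp' : p < 2 / 3) (hm : 0 ≤ m)
    (hε : 0 < ε) (hε1 : ε < 1) (hv : m * (α - 4 * ε ^ 2) ≤ v) :
    (2 * p - 1) * (m * (α - 40 * ε)) ≤ p * v - (1 - p) * (m * (α + ε ^ 4)) := by
  have hε2 : ε ^ 2 ≤ ε := by nlinarith
  have hε4 : ε ^ 4 ≤ ε ^ 2 := pow_le_pow_of_le_one hε.le hε1.le (by norm_num)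
  have hmε : 0 ≤ m * ε := by positivity
  have hmε2 : m * ε ^ 2 ≤ m * ε := by gcongr
  have hmε4 : m * ε ^ 4 ≤ m * ε ^ 2 := by gcongr
  have hmε20 : 0 ≤ m * ε ^ 2 := by positivity
  have hmε40 : 0 ≤ m * ε ^ 4 := by positivity
  have h3 : p * (m * (α - 4 * ε ^ 2)) ≤ p * v := mul_le_mul_of_nonneg_left hv (by linarith)
  have h4 : p * (m * ε ^ 2) ≤ 1 * (m * ε ^ 2) := mul_le_mul_of_nonneg_right (by linarith) hmε20
  have h5 : 5 / 8 * (m * ε) ≤ p * (m * ε) := mul_le_mul_of_nonneg_right hp.le hmε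
  have h6 : (1 - p) * (m * ε ^ 4) ≤ 1 * (m * ε ^ 4) :=
    mul_le_mul_of_nonneg_right (by linarith) hmε40
  linarith

/-- The lower bound on the expected value for small accuracies. -/
theorem roundCorrelation_ge {K : ℝ} (hn : 1 ≤ n) {A : Matrix (Fin n) (Fin n) ℝ}
    {H : Matrix (Fin n ⊕ Fin n) (Fin n ⊕ Fin n) ℝ} {ε η : ℝ} (hε : 0 < ε) (hε1 : ε < 1)
    (hη : 0 < η) (hηε : η ≤ ε) (hH : H.IsSymm) (hHn : ‖H‖ ≤ K * Real.log (2 * n) / η)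
    (hsol : IsApproxSDPSolution (bipartiteMatrix A) (ε ^ 4) (gibbsState H)) {l : ℕ}
    (hl : (2 * K + 4) * Real.log (2 * n) / η ≤ l) :
    roundingConst A * (n * ‖A‖ * (sdpObjective (bipartiteMatrix A) (gibbsState H) - 40 * ε)) ≤
      entrywiseInner A (roundCorrelation H l).toBlocks₁₂ := by
  have : Nonempty (Fin n ⊕ Fin n) := ⟨.inl ⟨0, hn⟩⟩
  have hn' : (1 : ℝ) ≤ n := by exact_mod_cast hn
  have hδ : ‖taylorHalf H l * NormedSpace.exp ((1 / 2 : ℝ) • H) - 1‖ ≤ 3 / 10 * ε ^ 2 := by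
    refine (norm_taylorHalf_mul_exp_sub_one_le H l).trans ?_
    have hq : Real.log 2 / ε ≤ Real.log (2 * n) / η := by
      have h2 : Real.log 2 ≤ Real.log (2 * n) := Real.log_le_log (by norm_num) (by linarith)
      have h3 : 0 < Real.log 2 := Real.log_pos (by norm_num)
      have h4 : 0 ≤ Real.log (2 * n) := h3.le.trans h2
      gcongr
    -- With `q = log (2n) / η`, the exponent is at most `2 K q - (2 K + 4) q = -4 q`.
    refine le_trans (Real.exp_le_exp.2 ?_) (exp_neg_le_sq hε hq)
    rw [mul_div_assoc] at hHn hl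
    push_cast
    linarith
  have hε2 : ε ^ 2 ≤ ε := by nlinarith
  have hε4 : ε ^ 4 ≤ ε ^ 2 := by nlinarith [sq_nonneg ε]
  obtain ⟨U, hU1, hUT, hUf⟩ := exists_unit_rows hH hδ (by nlinarith) hsol.2.1
  set N : ℝ := (Fintype.card (Fin n ⊕ Fin n) : ℝ) with hN
  have hNpos : 0 < N := by rw [hN]; exact_mod_cast Fintype.card_pos
  set G := U * Uᵀ with hGdef
  have hG : IsCorrelation G := by
    refine ⟨?_, hU1⟩
    rw [hGdef, ← Matrix.conjTranspose_eq_transpose_of_trivial]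
    exact Matrix.posSemidef_self_mul_conjTranspose U
  have hGram : ((√N)⁻¹ • U) * ((√N)⁻¹ • U)ᵀ = (1 / N) • G := by
    rw [Matrix.transpose_smul, Matrix.smul_mul, Matrix.mul_smul, smul_smul, ← mul_inv,
      Real.mul_self_sqrt hNpos.le, one_div]
  have hF : frobeniusSq ((√N)⁻¹ • U) = 1 := by
    rw [frobeniusSq_eq_trace, hGram]
    exact (hG.isSDPFeasible hn).2.1
  -- `2 ε ^ 4 + 8 (3 / 10 * ε ^ 2) ^ 2 ≤ 4 ε ^ 4`.
  have hsq : √(frobeniusSq ((√N)⁻¹ • U - gibbsSqrt H)) ≤ 2 * ε ^ 2 := by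
    rw [Real.sqrt_le_left (by positivity)]
    have h4 := hsol.2.2.1
    nlinarith
  have hobj := abs_sdpObjective_gram_sub_le (bipartiteMatrix A) hF
    (frobeniusSq_gibbsSqrt hH hsol.2.1)
  rw [hGram, gibbsSqrt_mul_transpose hH] at hobj
  have hval := entrywiseInner_eq_sdpObjective hn A hG.1
  rw [← hN] at hval
  set α := sdpObjective (bipartiteMatrix A) (gibbsState H) with hα
  set m := n * ‖A‖ with hm
  have hm0 : 0 ≤ m := by positivity
  have hα1 : |α| ≤ 1 := by
    rw [hα, ← gibbsSqrt_mul_transpose hH]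
    exact abs_sdpObjective_gram_le _ (frobeniusSq_gibbsSqrt hH hsol.2.1)
  have hvge : m * (α - 4 * ε ^ 2) ≤ entrywiseInner A G.toBlocks₁₂ := by
    rw [hval]
    refine mul_le_mul_of_nonneg_left ?_ hm0
    linarith [(abs_le.1 hobj).1]
  have hopt : ∀ M : Matrix (Fin n ⊕ Fin n) (Fin n ⊕ Fin n) ℝ, IsCorrelation M →
      entrywiseInner A M.toBlocks₁₂ ≤ m * (α + ε ^ 4) := fun M hM => hsol.entrywiseInner_le hn hM
  have hX := isCorrelation_roundCorrelation H l
  have hXU : roundCorrelation H l =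
      signCorrelation gaussianSequence (fun i ω => gaussianVector n ω i) U :=
    signCorrelation_of_rows _ _ hUT
  have hP : (roundCorrelation H l - (2 / Real.pi) • G).PosSemidef := by
    rw [hXU]
    exact signCorrelation_sub_posSemidef hasLaw_gaussianVector iIndepFun_gaussianVector hU1
  have hp := two_div_pi_bounds
  have e4 : 4 / Real.pi - 1 = 2 * (2 / Real.pi) - 1 := by ring
  unfold roundingConst
  split_ifs with hA
  -- The threshold `τ = ε` balances the small-ball term `O(ε)` with the loss `O(ε ^ 2) / τ`.
  · have h := entrywiseInner_sign_ge_of_posSemidef hA hX hG hP hε (fun i => by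
      rw [hXU]
      exact two_sub_signCorrelation_le hasLaw_gaussianVector iIndepFun_gaussianVector hU1 _ _ hε)
      hopt
    exact (rounding_arith_of_posSemidef hp.1 hp.2 hm0 hε hε1 (abs_le.1 hα1).2 hvge).trans h
  · rw [e4]
    exact (rounding_arith hp.1 hp.2 hm0 hε hε1 hvge).trans (entrywiseInner_sign_ge hX.2 hG.2 hP hopt)

/-- The guarantees for the expected value of the rounding procedure. -/
theorem integral_round_bounds {K : ℝ} (hn : 1 ≤ n) {A : Matrix (Fin n) (Fin n) ℝ}
    {H : Matrix (Fin n ⊕ Fin n) (Fin n ⊕ Fin n) ℝ} {ε η : ℝ} (hε : 0 < ε)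
    (hη : 0 < η) (hηε : η ≤ ε) (hH : H.IsSymm) (hHn : ‖H‖ ≤ K * Real.log (2 * n) / η)
    (hsol : IsApproxSDPSolution (bipartiteMatrix A) (ε ^ 4) (gibbsState H)) {l : ℕ}
    (hl : (2 * K + 4) * Real.log (2 * n) / η ≤ l) {C : ℝ} (hC : 41 ≤ C) :
    roundingConst A * (inftyOneNorm A - C * (n * ‖A‖ * ε)) ≤
      ∫ ω, roundX H l ω ⬝ᵥ (A *ᵥ roundY H l ω) ∂gaussianSequence ∧
    ∫ ω, roundX H l ω ⬝ᵥ (A *ᵥ roundY H l ω) ∂gaussianSequence ≤ inftyOneNorm A ∧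
    roundingConst A *
        (n * ‖A‖ * (sdpObjective (bipartiteMatrix A) (gibbsState H) - C * ε)) ≤
      ∫ ω, roundX H l ω ⬝ᵥ (A *ᵥ roundY H l ω) ∂gaussianSequence ∧
    ∫ ω, roundX H l ω ⬝ᵥ (A *ᵥ roundY H l ω) ∂gaussianSequence ≤
      n * ‖A‖ * (sdpObjective (bipartiteMatrix A) (gibbsState H) + C * ε) := by
  have hγ := roundingConst_ge A
  have hα1 : |sdpObjective (bipartiteMatrix A) (gibbsState H)| ≤ 1 := by
    rw [← gibbsSqrt_mul_transpose hH]
    exact abs_sdpObjective_gram_le _ (frobeniusSq_gibbsSqrt hH hsol.2.1)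
  have hopt := fun (M : Matrix (Fin n ⊕ Fin n) (Fin n ⊕ Fin n) ℝ) (hM : IsCorrelation M) =>
    hsol.entrywiseInner_le hn hM
  have hinf := inftyOneNorm_le_of_correlation hopt
  have hinf' : inftyOneNorm A ≤ n * ‖A‖ :=
    inftyOneNorm_le fun x y hx hy => (le_abs_self _).trans (hx.abs_dotProduct_mulVec_le hy A)
  have hle : ∫ ω, roundX H l ω ⬝ᵥ (A *ᵥ roundY H l ω) ∂gaussianSequence ≤ inftyOneNorm A := by
    have h := integral_mono (integrable_round A H l) (integrable_const (inftyOneNorm A)) fun ω =>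
      (isSignVector_round H l ω).1.le_inftyOneNorm (isSignVector_round H l ω).2 A
    simpa using h
  have hge : -(n * ‖A‖) ≤ ∫ ω, roundX H l ω ⬝ᵥ (A *ᵥ roundY H l ω) ∂gaussianSequence := by
    have h := integral_mono (integrable_const (-(n * ‖A‖))) (integrable_round A H l) fun ω =>
      (abs_le.1 ((isSignVector_round H l ω).1.abs_dotProduct_mulVec_le
        (isSignVector_round H l ω).2 A)).1
    simpa using h
  have hX := hopt _ (isCorrelation_roundCorrelation H l)
  rw [← integral_round] at hX
  have hlow : ε < 1 → roundingConst A *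
      (n * ‖A‖ * (sdpObjective (bipartiteMatrix A) (gibbsState H) - 40 * ε)) ≤
      ∫ ω, roundX H l ω ⬝ᵥ (A *ᵥ roundY H l ω) ∂gaussianSequence := fun hε1 => by
    rw [integral_round]
    exact roundCorrelation_ge hn hε hε1 hη hηε hH hHn hsol hl
  set α := sdpObjective (bipartiteMatrix A) (gibbsState H) with hα
  set I := ∫ ω, roundX H l ω ⬝ᵥ (A *ᵥ roundY H l ω) ∂gaussianSequence with hI
  have hm0 : 0 ≤ n * ‖A‖ := by positivity
  generalize n * ‖A‖ = m at *
  have hmε : 0 ≤ m * ε := by positivity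
  obtain ⟨ha1, ha2⟩ := abs_le.1 hα1
  -- For `ε < 1`, one more unit beyond `40` absorbs the gap `ε ^ 4` between the optimum and the
  -- Gibbs value. For `ε ≥ 1` the bounds follow from `|⟨x, A y⟩| ≤ m`, because `roundingConst A ≥ 1
  -- / 4`.
  rcases lt_or_ge ε 1 with hε1 | hε1
  · have hε4 : ε ^ 4 ≤ ε := by
      calc ε ^ 4 ≤ ε ^ 1 := pow_le_pow_of_le_one hε.le hε1.le (by norm_num)
        _ = ε := pow_one ε
    have hmε4 : m * ε ^ 4 ≤ m * ε := by gcongr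
    refine ⟨le_trans ?_ (hlow hε1), hle, le_trans ?_ (hlow hε1), ?_⟩
    · refine mul_le_mul_of_nonneg_left ?_ (by linarith)
      nlinarith
    · refine mul_le_mul_of_nonneg_left (mul_le_mul_of_nonneg_left ?_ hm0) (by linarith)
      nlinarith
    · nlinarith
  · have hmm : m ≤ m * ε := by nlinarith
    have hCm : 41 * m ≤ C * (m * ε) := by nlinarith
    have hγm : 1 / 4 * m ≤ roundingConst A * m := by gcongr
    refine ⟨?_, hle, ?_, ?_⟩
    · have h : roundingConst A * (inftyOneNorm A - C * (m * ε)) ≤ roundingConst A * (-40 * m) :=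
        mul_le_mul_of_nonneg_left (by linarith) (by linarith)
      linarith
    · have h1 : m * (α - C * ε) ≤ -40 * m := by nlinarith
      have h : roundingConst A * (m * (α - C * ε)) ≤ roundingConst A * (-40 * m) :=
        mul_le_mul_of_nonneg_left h1 (by linarith)
      linarith
    · nlinarith
end

/-! ### Proof rules for programs with time bounds -/

/-- Started in `σ`, the program `p` halts within time `T` in a state that satisfies `Q`. -/
def Runs (O : MatrixOracle) (ω : ℕ → ℝ) (p : RAMProg) (σ : RAMState) (T : ℕ)
    (Q : RAMState → Prop) : Prop :=
  ∃ t τ, t ≤ T ∧ RAMExec O ω p σ t τ ∧ Q τ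

/-- The sequential composition of a nonempty list of instructions. -/
def straight : RAMInstr → List RAMInstr → RAMProg
  | c, [] => .instr c
  | c, d :: L => .seq (.instr c) (straight d L)

section
variable {O : MatrixOracle} {ω : ℕ → ℝ} {σ : RAMState} {Q R : RAMState → Prop} {T T' : ℕ}

theorem Runs.mono {p : RAMProg} (h : Runs O ω p σ T Q) (hT : T ≤ T') (hQ : ∀ τ, Q τ → R τ) :
    Runs O ω p σ T' R := by
  obtain ⟨t, τ, ht, he, hq⟩ := h
  exact ⟨t, τ, ht.trans hT, he, hQ τ hq⟩

theorem Runs.seq {p q : RAMProg} (hp : Runs O ω p σ T R) (hq : ∀ τ, R τ → Runs O ω q τ T' Q) :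
    Runs O ω (.seq p q) σ (T + T') Q := by
  obtain ⟨t, τ, ht, he, hr⟩ := hp
  obtain ⟨t', υ, ht', he', hq'⟩ := hq τ hr
  exact ⟨t + t', υ, Nat.add_le_add ht ht', .seq he he', hq'⟩

theorem Runs.straight (L : List RAMInstr) (c : RAMInstr) :
    ∀ {σ : RAMState}, Q ((c :: L).foldl (RAMInstr.effect O ω) σ) →
      Runs O ω (straight c L) σ (L.length + 1) Q := by
  induction L generalizing c with
  | nil => intro σ h; exact ⟨1, _, by simp, .instr c σ, h⟩
  | cons d L ih =>
    intro σ h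
    obtain ⟨t, τ, ht, he, hq⟩ := ih d (σ := c.effect O ω σ) h
    exact ⟨1 + t, τ, by simp only [List.length_cons]; omega, .seq (.instr c σ) he, hq⟩

theorem Runs.ifNonneg {a : ℕ} {p q : RAMProg} (hp : 0 ≤ σ.rreg a → Runs O ω p σ T Q)
    (hq : σ.rreg a < 0 → Runs O ω q σ T Q) : Runs O ω (.ifNonneg a p q) σ (T + 1) Q := by
  rcases le_or_gt 0 (σ.rreg a) with h | h
  · obtain ⟨t, τ, ht, he, hr⟩ := hp h
    exact ⟨t + 1, τ, by omega, .ifPos q h he, hr⟩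
  · obtain ⟨t, τ, ht, he, hr⟩ := hq h
    exact ⟨t + 1, τ, by omega, .ifNeg p h he, hr⟩

/-- The rule for loops with an invariant that is indexed by the number of completed rounds. -/
theorem Runs.whileLt {a b : ℕ} {p : RAMProg} (Inv : ℕ → RAMState → Prop) (m : ℕ)
    (hstep : ∀ i, i < m → ∀ σ, Inv i σ → σ.nreg a < σ.nreg b ∧ Runs O ω p σ T (Inv (i + 1)))
    (hdone : ∀ σ, Inv m σ → σ.nreg b ≤ σ.nreg a) (h0 : Inv 0 σ) :
    Runs O ω (.whileLt a b p) σ (m * (T + 1) + 1) (Inv m) := by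
  have key : ∀ d i, i + d = m → ∀ σ, Inv i σ →
      Runs O ω (.whileLt a b p) σ (d * (T + 1) + 1) (Inv m) := by
    intro d
    induction d with
    | zero =>
      intro i hi σ hσ
      obtain rfl : i = m := by omega
      exact ⟨1, σ, by simp, .whileDone p (hdone σ hσ), hσ⟩
    | succ d ih =>
      intro i hi σ hσ
      obtain ⟨hlt, t, τ, ht, he, hτ⟩ := hstep i (by omega) σ hσ
      obtain ⟨u, υ, hu, he', hυ⟩ := ih (i + 1) (by omega) τ hτ
      exact ⟨t + u + 1, υ, by rw [Nat.succ_mul]; omega, .whileStep hlt he he', hυ⟩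
  exact key m 0 (by omega) σ h0

end

/-! ### The program -/

/-- One step of the product of a row with a vector; the row is register `5`, the column is
register `8`, its position in the adjacency list is register `7`, and the vector starts at the
address in register `9` of array `1`. -/
def dotStep : RAMProg :=
  straight (.queryEntry 0 5 8) [.nadd 11 9 8, .load 1 1 11, .rmul 0 0 1, .radd 2 2 0, .nadd 7 7 3,
    .queryPos 8 5 7]

/-- Compute one entry of the next term of the Taylor series, and add it to the partial sum in
array `0`. -/
def rowStep : RAMProg :=
  .seq (straight (.rsub 2 5 5) [.nconst 7 0, .queryPos 8 5 7])
    (.seq (.whileLt 8 2 dotStep)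
      (straight (.rdiv 2 2 3) [.nadd 11 9 2, .nadd 11 11 5, .store 1 11 2, .load 0 0 5,
        .radd 0 0 2, .store 0 5 0, .nadd 5 5 3]))

/-- Compute the next term of the Taylor series. -/
def termStep : RAMProg :=
  .seq (straight (.nadd 6 6 3) [.nadd 11 6 6, .rofNat 3 11, .rsub 3 5 3, .nconst 5 0])
    (.seq (.whileLt 5 2 rowStep) (.instr (.nadd 9 9 2)))

/-- Replace one entry of array `0` by its sign. -/
def signStep : RAMProg :=
  .seq (.instr (.load 0 0 5))
    (.seq (.ifNonneg 0 (.instr (.store 0 5 4)) (.instr (.store 0 5 3))) (.instr (.nadd 5 5 3)))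

/-- Draw one random number. -/
def drawStep : RAMProg := straight (.gauss 0) [.store 0 5 0, .store 1 5 0, .nadd 5 5 3]

/-- The rounding procedure. -/
def roundingProg : RAMProg :=
  .seq (straight (.nadd 2 0 0) [.nconst 3 1])
    (.seq (.whileLt 5 2 drawStep)
      (.seq (.whileLt 6 1 termStep)
        (.seq (straight (.nconst 5 0) [.rofNat 4 3, .rsub 3 5 4]) (.whileLt 5 2 signStep))))

/-! ### Correctness and cost of the program -/

section
variable {N : ℕ} (M : Matrix (Fin N) (Fin N) ℝ)

/-- The columns of the nonzero entries of a row, in increasing order. -/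
noncomputable def rowSupport (i : Fin N) : List ℕ :=
  ((Finset.univ.filter fun j : Fin N => M i j ≠ 0).sort (· ≤ ·)).map Fin.val

theorem adjacencyOracle_pos (i : Fin N) (k : ℕ) :
    (adjacencyOracle M).pos i k = (rowSupport M i).getD k N := by
  simp [adjacencyOracle, rowSupport]

theorem adjacencyOracle_entry (i j : Fin N) : (adjacencyOracle M).entry i j = M i j := by
  simp [adjacencyOracle]

theorem lt_of_mem_rowSupport {i : Fin N} {x : ℕ} (hx : x ∈ rowSupport M i) : x < N := by
  simp only [rowSupport, List.mem_map] at hx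
  obtain ⟨j, -, rfl⟩ := hx
  exact j.2

theorem rowSupport_sum (i : Fin N) (f : ℕ → ℝ) :
    ((rowSupport M i).map fun j => (adjacencyOracle M).entry i j * f j).sum
      = ∑ j : Fin N, M i j * f j := by
  have h1 : ∑ j : Fin N, M i j * f j
      = ∑ j ∈ Finset.univ.filter (fun j : Fin N => M i j ≠ 0), M i j * f j := by
    rw [Finset.sum_filter]
    refine Finset.sum_congr rfl fun j _ => ?_
    split_ifs with h
    · rfl
    · rw [not_not.1 h, zero_mul]
  rw [h1, rowSupport, List.map_map]
  have h2 : ∀ j : Fin N, ((fun j => (adjacencyOracle M).entry i j * f j) ∘ Fin.val) j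
      = M i j * f j := fun j => by simp [adjacencyOracle_entry]
  rw [List.map_congr_left fun j _ => h2 j]
  have h3 := Finset.sort_toFinset (Finset.univ.filter fun j : Fin N => M i j ≠ 0) (· ≤ ·)
  have h4 := List.sum_toFinset (fun j : Fin N => M i j * f j)
    (Finset.sort_nodup (Finset.univ.filter fun j : Fin N => M i j ≠ 0) (· ≤ ·))
  rw [← h4, h3]

/-- The registers that are constant while a term of the Taylor series is computed. -/
structure TermContext (l k b : ℕ) (c : ℝ) (N : ℕ) (σ : RAMState) : Prop where
  terms : σ.nreg 1 = l
  dim : σ.nreg 2 = N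
  one : σ.nreg 3 = 1
  counter : σ.nreg 6 = k
  base : σ.nreg 9 = b
  divisor : σ.rreg 3 = c
  zero : σ.rreg 5 = 0

theorem runs_dotLoop (ω : ℕ → ℝ) {l k b : ℕ} {c : ℝ} (i : Fin N) {m : ℕ → ℕ → ℝ} {σ : RAMState}
    (hc : TermContext l k b c N σ) (h5 : σ.nreg 5 = i) (hm : σ.mem = m) (h7 : σ.nreg 7 = 0)
    (h8 : σ.nreg 8 = (rowSupport M i).getD 0 N) (hr : σ.rreg 2 = 0) :
    Runs (adjacencyOracle M) ω (.whileLt 8 2 dotStep) σ ((rowSupport M i).length * 8 + 1)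
      fun τ => TermContext l k b c N τ ∧ τ.nreg 5 = i ∧ τ.mem = m ∧
        τ.rreg 2 = ∑ j : Fin N, M i j * m 1 (b + j) := by
  set L := rowSupport M i with hL
  refine (Runs.whileLt (T := 7) (fun x τ => TermContext l k b c N τ ∧ τ.nreg 5 = i ∧ τ.mem = m ∧
    τ.nreg 7 = x ∧ τ.nreg 8 = L.getD x N ∧ τ.rreg 2 =
      ((L.take x).map fun j => (adjacencyOracle M).entry i j * m 1 (b + j)).sum) L.length
    ?_ ?_ ?_).mono le_rfl ?_
  · rintro x hx τ ⟨hc, h5, hm, h7, h8, h2⟩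
    have hget : L.getD x N = L[x] := by simp [hx]
    refine ⟨?_, Runs.straight _ _ ?_⟩
    · rw [h8, hc.dim, hget]
      exact lt_of_mem_rowSupport M (List.getElem_mem hx)
    · refine ⟨⟨?_, ?_, ?_, ?_, ?_, ?_, ?_⟩, ?_, ?_, ?_, ?_, ?_⟩
      all_goals simp [RAMInstr.effect, RAMState.setN, RAMState.setR,
        hc.terms, hc.dim, hc.one, hc.counter, hc.base, hc.divisor, hc.zero, h5, hm, h7]
      · rw [adjacencyOracle_pos, ← hL, List.getD_eq_getElem?_getD]
      · rw [h8, h2, hget, ← List.map_take, List.take_succ_eq_append_getElem hx, List.map_append,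
          List.sum_append]
        simp
  -- Past the end of the adjacency list the oracle answers `N`, which is not below the dimension
  -- register and stops the loop.
  · rintro τ ⟨hc, -, -, -, h8, -⟩
    rw [h8, hc.dim]
    simp
  · exact ⟨hc, h5, hm, h7, h8, by simpa using hr⟩
  · rintro τ ⟨hc, h5, hm, -, -, h2⟩
    refine ⟨hc, h5, hm, ?_⟩
    rw [h2, List.take_length, hL, rowSupport_sum M i fun j => m 1 (b + j)]

theorem runs_rowStep (ω : ℕ → ℝ) {l k b s : ℕ} {c : ℝ} (i : Fin N) {m : ℕ → ℕ → ℝ} {σ : RAMState}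
    (hs : (rowSupport M i).length ≤ s + 1)
    (hc : TermContext l k b c N σ) (h5 : σ.nreg 5 = i) (hm : σ.mem = m) :
    Runs (adjacencyOracle M) ω rowStep σ (8 * s + 20) fun τ => TermContext l k b c N τ ∧
      τ.nreg 5 = i + 1 ∧
      τ.mem 1 = Function.update (m 1) (b + N + i) ((∑ j : Fin N, M i j * m 1 (b + j)) / c) ∧
      τ.mem 0 = Function.update (m 0) i (m 0 i + (∑ j : Fin N, M i j * m 1 (b + j)) / c) := by
  have h1 : Runs (adjacencyOracle M) ω
      (straight (.rsub 2 5 5) [.nconst 7 0, .queryPos 8 5 7]) σ 3 fun τ =>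
      TermContext l k b c N τ ∧ τ.nreg 5 = i ∧ τ.mem = m ∧ τ.nreg 7 = 0 ∧
      τ.nreg 8 = (rowSupport M i).getD 0 N ∧ τ.rreg 2 = 0 := by
    refine Runs.straight _ _ ?_
    refine ⟨⟨?_, ?_, ?_, ?_, ?_, ?_, ?_⟩, ?_, ?_, ?_, ?_, ?_⟩
    all_goals simp [RAMInstr.effect, RAMState.setN, RAMState.setR,
        hc.terms, hc.dim, hc.one, hc.counter, hc.base, hc.divisor, hc.zero, h5, hm]
    rw [adjacencyOracle_pos, List.getD_eq_getElem?_getD]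
  refine ((h1.seq fun τ hτ => (runs_dotLoop M ω i hτ.1 hτ.2.1 hτ.2.2.1 hτ.2.2.2.1 hτ.2.2.2.2.1
    hτ.2.2.2.2.2).seq (T' := 8) fun υ hυ => ?_).mono (T := 3 + (((rowSupport M i).length * 8 + 1) + 8))
      (by omega) fun _ h => h)
  obtain ⟨hc, h5, hm, h2⟩ := hυ
  refine Runs.straight _ _ ?_
  refine ⟨⟨?_, ?_, ?_, ?_, ?_, ?_, ?_⟩, ?_, ?_, ?_⟩
  all_goals simp [RAMInstr.effect, RAMState.setN, RAMState.setR,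
        hc.terms, hc.dim, hc.one, hc.counter, hc.base, hc.divisor, hc.zero, h5, hm, h2]

/-- The `k`-th term of the Taylor series, applied to `g`. -/
noncomputable def taylorTerm (g : Fin N → ℝ) : ℕ → Fin N → ℝ
  | 0 => g
  | k + 1 => fun i => (∑ j, M i j * taylorTerm g k j) / (-(2 * (k + 1 : ℝ)))

theorem runs_termStep (ω : ℕ → ℝ) {l s : ℕ} {c : ℝ} (g : Fin N → ℝ) {σ : RAMState} {k : ℕ}
    (hs : ∀ i, (rowSupport M i).length ≤ s + 1)
    (hc : TermContext l k (k * N) c N σ)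
    (h1 : ∀ i : Fin N, σ.mem 1 (k * N + i) = taylorTerm M g k i)
    (h0 : ∀ i : Fin N, σ.mem 0 i = ∑ x ∈ Finset.range (k + 1), taylorTerm M g x i) :
    Runs (adjacencyOracle M) ω termStep σ (7 + N * (8 * s + 21)) fun τ =>
      TermContext l (k + 1) ((k + 1) * N) (-(2 * (k + 1 : ℝ))) N τ ∧
      (∀ i : Fin N, τ.mem 1 ((k + 1) * N + i) = taylorTerm M g (k + 1) i) ∧
      (∀ i : Fin N, τ.mem 0 i = ∑ x ∈ Finset.range (k + 1 + 1), taylorTerm M g x i) := by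
  set c' : ℝ := -(2 * (k + 1 : ℝ)) with hc'
  have e1 : Runs (adjacencyOracle M) ω
      (straight (.nadd 6 6 3) [.nadd 11 6 6, .rofNat 3 11, .rsub 3 5 3, .nconst 5 0]) σ 5 fun τ =>
      TermContext l (k + 1) (k * N) c' N τ ∧ τ.nreg 5 = 0 ∧ τ.mem = σ.mem := by
    refine Runs.straight _ _ ?_
    refine ⟨⟨?_, ?_, ?_, ?_, ?_, ?_, ?_⟩, ?_, ?_⟩
    all_goals simp [RAMInstr.effect, RAMState.setN, RAMState.setR,
        hc.terms, hc.dim, hc.one, hc.counter, hc.base, hc.zero]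
    rw [hc']; ring
  refine (e1.seq fun τ hτ => Runs.seq (R := fun υ => TermContext l (k + 1) (k * N) c' N υ ∧
    (∀ i : Fin N, υ.mem 1 (k * N + N + i) = taylorTerm M g (k + 1) i) ∧
    (∀ i : Fin N, υ.mem 0 i = ∑ x ∈ Finset.range (k + 1 + 1), taylorTerm M g x i))
    (T := N * (8 * s + 21) + 1) (T' := 1) ?_ ?_).mono (by omega) fun _ h => h
  -- After `x` rows the new term and the updated partial sums are present for indices below `x`; the
  -- remaining partial sums and the whole previous term are untouched.
  · refine (Runs.whileLt (T := 8 * s + 20) (fun x υ => TermContext l (k + 1) (k * N) c' N υ ∧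
      υ.nreg 5 = x ∧ (∀ i : Fin N, υ.mem 1 (k * N + i) = taylorTerm M g k i) ∧
      (∀ i : Fin N, i < x → υ.mem 1 (k * N + N + i) = taylorTerm M g (k + 1) i) ∧
      (∀ i : Fin N, i < x → υ.mem 0 i = ∑ y ∈ Finset.range (k + 1 + 1), taylorTerm M g y i) ∧
      (∀ i : Fin N, x ≤ i → υ.mem 0 i = ∑ y ∈ Finset.range (k + 1), taylorTerm M g y i))
      N ?_ ?_ ?_).mono le_rfl ?_
    · rintro x hx υ ⟨hcυ, h5, hm, hm1, hm0, hm0'⟩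
      refine ⟨by rw [h5, hcυ.dim]; exact hx, ?_⟩
      refine (runs_rowStep M ω ⟨x, hx⟩ (hs _) hcυ h5 rfl).mono le_rfl ?_
      rintro υ' ⟨hcυ', h5', e1, e0⟩
      have hv : (∑ j : Fin N, M ⟨x, hx⟩ j * υ.mem 1 (k * N + j)) / c'
          = taylorTerm M g (k + 1) ⟨x, hx⟩ := by
        simp_rw [hm]; rfl
      rw [hv] at e0 e1
      refine ⟨hcυ', h5', fun i => ?_, fun i hi => ?_, fun i hi => ?_, fun i hi => ?_⟩
      -- Each term has its own block of `N` addresses in array `1`, so writing term `k + 1` never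
      -- destroys term `k`, which later rows still read.
      · rw [e1, Function.update_of_ne (by have := i.2; simp only; omega), hm]
      · rw [e1]
        rcases Nat.lt_succ_iff_lt_or_eq.1 hi with h | h
        · rw [Function.update_of_ne (by simp only; omega), hm1 i h]
        · obtain rfl : i = ⟨x, hx⟩ := Fin.ext h
          rw [Function.update_self]
      · rw [e0]
        rcases Nat.lt_succ_iff_lt_or_eq.1 hi with h | h
        · rw [Function.update_of_ne (by simp only; omega), hm0 i h]
        · obtain rfl : i = ⟨x, hx⟩ := Fin.ext h
          rw [Function.update_self, hm0' ⟨x, hx⟩ le_rfl, Finset.sum_range_succ _ (k + 1)]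
      · rw [e0, Function.update_of_ne (by simp only; omega), hm0' i (by omega)]
    · rintro υ ⟨hcυ, h5, -⟩
      rw [h5, hcυ.dim]
    · obtain ⟨hcτ, h5, hm⟩ := hτ
      exact ⟨hcτ, h5, by rw [hm]; exact h1, fun i hi => absurd hi (by omega),
        fun i hi => absurd hi (by omega), fun i _ => by rw [hm]; exact h0 i⟩
    · rintro υ ⟨hcυ, -, -, hm1, hm0, -⟩
      exact ⟨hcυ, fun i => hm1 i i.2, fun i => hm0 i i.2⟩
  · rintro υ ⟨hcυ, hm1, hm0⟩
    refine Runs.straight [] _ ?_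
    refine ⟨⟨?_, ?_, ?_, ?_, ?_, ?_, ?_⟩, ?_, ?_⟩
    all_goals simp [RAMInstr.effect, RAMState.setN, hcυ.terms,
      hcυ.dim, hcυ.one, hcυ.counter, hcυ.base, hcυ.divisor, hcυ.zero, Nat.succ_mul, hm1]
    exact hm0

theorem runs_signStep (O : MatrixOracle) (ω : ℕ → ℝ) {x : ℕ} {σ : RAMState}
    (h5 : σ.nreg 5 = x) (h3 : σ.nreg 3 = 1) (h2 : σ.nreg 2 = N) (r4 : σ.rreg 4 = 1)
    (r3 : σ.rreg 3 = -1) :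
    Runs O ω signStep σ 4 fun τ => τ.nreg 5 = x + 1 ∧ τ.nreg 3 = 1 ∧ τ.nreg 2 = N ∧
      τ.rreg 4 = 1 ∧ τ.rreg 3 = -1 ∧
      τ.mem 0 = Function.update (σ.mem 0) x (signPM (σ.mem 0 x)) := by
  have e1 : Runs O ω (.instr (.load 0 0 5)) σ 1 fun τ => τ.nreg = σ.nreg ∧ τ.rreg 4 = 1 ∧
      τ.rreg 3 = -1 ∧ τ.rreg 0 = σ.mem 0 x ∧ τ.mem = σ.mem := by
    refine Runs.straight [] _ ?_
    simp [RAMInstr.effect, RAMState.setR, h5, r3, r4]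
  refine e1.seq fun τ ⟨t1, t2, t3, t4, t5⟩ => Runs.seq (T := 2) (T' := 1)
    (R := fun υ => υ.nreg = σ.nreg ∧ υ.rreg 4 = 1 ∧ υ.rreg 3 = -1 ∧
      υ.mem 0 = Function.update (σ.mem 0) x (signPM (σ.mem 0 x))) ?_ ?_
  · refine Runs.ifNonneg (fun h => Runs.straight [] _ ?_) fun h => Runs.straight [] _ ?_
    · rw [t4] at h
      simp [RAMInstr.effect, t1, t2, t3, t5, h5, signPM, h]
    · rw [t4] at h
      simp [RAMInstr.effect, t1, t2, t3, t5, h5, signPM, not_le.2 h]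
  · rintro υ ⟨u1, u2, u3, u4⟩
    refine Runs.straight [] _ ?_
    simp [RAMInstr.effect, RAMState.setN, u1, u2, u3, u4, h5, h3, h2]

theorem runs_roundingProg (ω : ℕ → ℝ) {n l s : ℕ} (M : Matrix (Fin (n + n)) (Fin (n + n)) ℝ)
    (hs : ∀ i, (rowSupport M i).length ≤ s + 1) :
    Runs (adjacencyOracle M) ω roundingProg (RAMState.init n l)
      (8 + (n + n) * 10 + l * (8 + (n + n) * (8 * s + 21))) fun τ =>
      ∀ i : Fin (n + n), τ.mem 0 i =
        signPM (∑ k ∈ Finset.range (l + 1), taylorTerm M (fun j => ω j) k i) := by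
  have e1 : Runs (adjacencyOracle M) ω (straight (.nadd 2 0 0) [.nconst 3 1]) (RAMState.init n l) 2
      fun τ => TermContext l 0 0 0 (n + n) τ ∧ τ.nreg 5 = 0 ∧ τ.drawn = 0 := by
    refine Runs.straight _ _ ?_
    refine ⟨⟨?_, ?_, ?_, ?_, ?_, ?_, ?_⟩, ?_, ?_⟩
    all_goals simp [RAMInstr.effect, RAMState.setN, RAMState.init]
  refine (e1.seq fun τ hτ => Runs.seq (T := (n + n) * 5 + 1)
    (T' := (l * (8 + (n + n) * (8 * s + 21)) + 1) + (3 + ((n + n) * 5 + 1)))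
    (R := fun υ => TermContext l 0 0 0 (n + n) υ ∧
      (∀ i : Fin (n + n), υ.mem 0 i = ω i) ∧ ∀ i : Fin (n + n), υ.mem 1 i = ω i)
    ?_ fun υ hυ => ?_).mono (by omega) fun _ h => h
  · refine (Runs.whileLt (T := 4) (fun x υ => TermContext l 0 0 0 (n + n) υ ∧ υ.nreg 5 = x ∧
      υ.drawn = x ∧ ∀ i, i < x → υ.mem 0 i = ω i ∧ υ.mem 1 i = ω i) (n + n) ?_ ?_ ?_).mono le_rfl ?_
    · rintro x hx υ ⟨hc, h5, hd, hm⟩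
      refine ⟨by rw [h5, hc.dim]; exact hx, Runs.straight _ _ ?_⟩
      refine ⟨⟨?_, ?_, ?_, ?_, ?_, ?_, ?_⟩, ?_, ?_, ?_⟩
      all_goals simp [RAMInstr.effect, RAMState.setN, RAMState.setR, hc.terms, hc.dim, hc.one,
        hc.counter, hc.base, hc.divisor, hc.zero, h5, hd]
      intro i hi
      rcases hi.lt_or_eq with h | rfl
      · simpa [Function.update_of_ne h.ne] using hm i h
      · simp
    · rintro υ ⟨hc, h5, -⟩
      rw [h5, hc.dim]
    · exact ⟨hτ.1, hτ.2.1, hτ.2.2, fun i hi => absurd hi (by omega)⟩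
    · rintro υ ⟨hc, -, -, hm⟩
      exact ⟨hc, fun i => (hm i i.2).1, fun i => (hm i i.2).2⟩
  · obtain ⟨hc, hm0, hm1⟩ := hυ
    refine Runs.seq (R := fun τ => τ.nreg 2 = n + n ∧ τ.nreg 3 = 1 ∧ τ.rreg 5 = 0 ∧
      ∀ i : Fin (n + n), τ.mem 0 i
        = ∑ k ∈ Finset.range (l + 1), taylorTerm M (fun j => ω j) k i) ?_ fun υ' hυ' => ?_
    -- The divisor is existential: it changes with `k`, is `0` initially, and is set anew at the
    -- start of each round before it is used.
    · refine (Runs.whileLt (T := 7 + (n + n) * (8 * s + 21)) (fun k τ =>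
        (∃ c, TermContext l k (k * (n + n)) c (n + n) τ) ∧
        (∀ i : Fin (n + n), τ.mem 1 (k * (n + n) + i) = taylorTerm M (fun j => ω j) k i) ∧
        (∀ i : Fin (n + n), τ.mem 0 i
          = ∑ x ∈ Finset.range (k + 1), taylorTerm M (fun j => ω j) x i)) l ?_ ?_ ?_).mono
          (by apply le_of_eq; ring) ?_
      · rintro k hk τ ⟨⟨c, hc⟩, h1, h0⟩
        refine ⟨by rw [hc.counter, hc.terms]; exact hk, ?_⟩
        exact (runs_termStep M ω (fun j => ω j) hs hc h1 h0).mono le_rfl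
          fun _ h => ⟨⟨_, h.1⟩, h.2⟩
      · rintro τ ⟨⟨c, hc⟩, -⟩
        rw [hc.counter, hc.terms]
      · exact ⟨⟨0, by rw [zero_mul]; exact hc⟩, by simpa [taylorTerm] using hm1,
          by simpa [taylorTerm] using hm0⟩
      · rintro τ ⟨⟨c, hc⟩, -, h0⟩
        exact ⟨hc.dim, hc.one, hc.zero, h0⟩
    · obtain ⟨h2, h3, r5, hm⟩ := hυ'
      set z : Fin (n + n) → ℝ :=
        fun i => ∑ k ∈ Finset.range (l + 1), taylorTerm M (fun j => ω j) k i with hz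
      have e2 : Runs (adjacencyOracle M) ω (straight (.nconst 5 0) [.rofNat 4 3, .rsub 3 5 4]) υ' 3
          fun τ => τ.nreg 5 = 0 ∧ τ.nreg 3 = 1 ∧ τ.nreg 2 = n + n ∧ τ.rreg 4 = 1 ∧
            τ.rreg 3 = -1 ∧ τ.mem = υ'.mem := by
        refine Runs.straight _ _ ?_
        simp [RAMInstr.effect, RAMState.setN, RAMState.setR, h2, h3, r5]
      refine e2.seq fun τ ⟨t5, t3, t2, s4, s3, tm⟩ => ?_
      refine (Runs.whileLt (T := 4) (fun x υ => (υ.nreg 5 = x ∧ υ.nreg 3 = 1 ∧ υ.nreg 2 = n + n ∧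
        υ.rreg 4 = 1 ∧ υ.rreg 3 = -1) ∧ (∀ i : Fin (n + n), i < x → υ.mem 0 i = signPM (z i)) ∧
        ∀ i : Fin (n + n), x ≤ i → υ.mem 0 i = z i) (n + n) ?_ ?_ ?_).mono le_rfl ?_
      · rintro x hx υ ⟨⟨u5, u3, u2, v4, v3⟩, hlt, hge⟩
        refine ⟨by rw [u5, u2]; exact hx, ?_⟩
        refine (runs_signStep _ ω u5 u3 u2 v4 v3).mono le_rfl ?_
        rintro υ' ⟨a1, a2, a3, a4, a5, am⟩
        refine ⟨⟨a1, a2, a3, a4, a5⟩, fun i hi => ?_, fun i hi => ?_⟩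
        · rw [am]
          rcases Nat.lt_succ_iff_lt_or_eq.1 hi with h | h
          · rw [Function.update_of_ne h.ne, hlt i h]
          · obtain rfl : i = ⟨x, hx⟩ := Fin.ext h
            rw [Function.update_self]
            exact congrArg signPM (hge ⟨x, hx⟩ le_rfl)
        · rw [am, Function.update_of_ne (by omega), hge i (by omega)]
      · rintro υ ⟨⟨u5, u3, u2, v4, v3⟩, -⟩
        rw [u5, u2]
      · exact ⟨⟨t5, t3, t2, s4, s3⟩, fun i hi => absurd hi (by omega),
          fun i _ => by rw [tm]; exact hm i⟩
      · rintro υ ⟨-, hlt, -⟩ i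
        exact hlt i i.2
end

/-! ### Transfer to the Hamiltonian and running time -/

section
variable {n : ℕ} (H : Matrix (Fin n ⊕ Fin n) (Fin n ⊕ Fin n) ℝ)

/-- The division by `-(2 (k + 1))` in each round accumulates to the sign of `(-H) ^ k` and to the
coefficient `1 / (2 ^ k k!)`. -/
theorem taylorTerm_reindex (ω : ℕ → ℝ) (k : ℕ) (a : Fin n ⊕ Fin n) :
    taylorTerm (H.reindex finSumFinEquiv finSumFinEquiv) (fun j => ω j) k (finSumFinEquiv a) =
      ((((2 : ℝ) ^ k * (k.factorial : ℝ))⁻¹ • (-H) ^ k) *ᵥ gaussianVector n ω) a := by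
  induction k generalizing a with
  | zero => simp [taylorTerm, gaussianVector]
  | succ k ih =>
    rw [taylorTerm]
    beta_reduce
    rw [← finSumFinEquiv.sum_comp]
    simp_rw [ih, Matrix.smul_mulVec, pow_succ' (-H), ← Matrix.mulVec_mulVec, Matrix.neg_mulVec]
    generalize (-H) ^ k *ᵥ gaussianVector n ω = V
    have h2 : ((k : ℝ) + 1) ≠ 0 := by positivity
    have h3 : (k.factorial : ℝ) ≠ 0 := by positivity
    simp only [Matrix.reindex_apply, Matrix.submatrix_apply, Equiv.symm_apply_apply, Pi.smul_apply,
      Pi.neg_apply, smul_eq_mul, Matrix.mulVec, dotProduct, Nat.factorial_succ, Nat.cast_mul,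
      Nat.cast_add, Nat.cast_one]
    have h4 : ∑ b, H a b * ((2 ^ k * (k.factorial : ℝ))⁻¹ * V b)
        = (2 ^ k * (k.factorial : ℝ))⁻¹ * ∑ b, H a b * V b := by
      rw [Finset.mul_sum]
      exact Finset.sum_congr rfl fun b _ => by ring
    rw [h4]
    field_simp
    ring

theorem sum_taylorTerm_reindex (ω : ℕ → ℝ) (l : ℕ) (a : Fin n ⊕ Fin n) :
    ∑ k ∈ Finset.range (l + 1),
      taylorTerm (H.reindex finSumFinEquiv finSumFinEquiv) (fun j => ω j) k (finSumFinEquiv a) =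
      (taylorHalf H l *ᵥ gaussianVector n ω) a := by
  simp_rw [taylorTerm_reindex, taylorHalf, Matrix.sum_mulVec, Finset.sum_apply]

/-- The extra `1` accounts for the diagonal entry, which the sparsity condition ignores. -/
theorem length_rowSupport_le {s : ℕ} (hs : IsOffDiagSparse s H) (i : Fin (n + n)) :
    (rowSupport (H.reindex finSumFinEquiv finSumFinEquiv) i).length ≤ s + 1 := by
  obtain ⟨a, rfl⟩ := finSumFinEquiv.surjective i
  rw [rowSupport, List.length_map, Finset.length_sort]
  have h1 : (Finset.univ.filter fun j : Fin (n + n) =>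
      H.reindex finSumFinEquiv finSumFinEquiv (finSumFinEquiv a) j ≠ 0).card
      = (Finset.univ.filter fun b => H a b ≠ 0).card := by
    symm
    refine Finset.card_bij (fun b _ => finSumFinEquiv b) ?_ ?_ ?_
    · intro b hb; simpa using hb
    · intro b _ b' _ h; exact finSumFinEquiv.injective h
    · intro j hj
      obtain ⟨b, rfl⟩ := finSumFinEquiv.surjective j
      exact ⟨b, by simpa using hj, rfl⟩
  rw [h1]
  have h2 := hs a
  rw [Set.ncard_eq_toFinset_card'] at h2
  have h3 : (Finset.univ.filter fun b => H a b ≠ 0) ⊆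
      insert a {j | j ≠ a ∧ H a j ≠ 0}.toFinset := fun b hb => by
    simp only [Finset.mem_filter, Finset.mem_univ, true_and] at hb
    by_cases h : b = a <;> simp [h, hb]
  exact (Finset.card_le_card h3).trans ((Finset.card_insert_le _ _).trans (by omega))

theorem exec_roundingProg {s : ℕ} (hn : 1 ≤ n) (hs1 : 1 ≤ s) (hs : IsOffDiagSparse s H) (l : ℕ)
    (ω : ℕ → ℝ) :
    ∃ (t : ℕ) (τ : RAMState),
      RAMExec (hamiltonianOracle H) ω roundingProg (RAMState.init n l) t τ ∧
      t ≤ 100 * (n * s * (1 + l)) ∧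
      (∀ i : Fin n, τ.mem 0 i = roundX H l ω i) ∧
      (∀ i : Fin n, τ.mem 0 (n + i) = roundY H l ω i) := by
  obtain ⟨t, τ, ht, he, hτ⟩ := runs_roundingProg ω (l := l)
    (H.reindex finSumFinEquiv finSumFinEquiv) (length_rowSupport_le H hs)
  refine ⟨t, τ, he, ht.trans ?_, fun i => ?_, fun i => ?_⟩
  · have h1 : 1 ≤ n * s := Nat.mul_pos hn hs1
    have h2 : n ≤ n * s := Nat.le_mul_of_pos_right n hs1
    have h3 : 8 + (n + n) * 10 ≤ 28 * (n * s) := by omega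
    have h4 : 8 + (n + n) * (8 * s + 21) ≤ 66 * (n * s) := by
      have : (n + n) * (8 * s + 21) = 16 * (n * s) + 42 * n := by ring
      omega
    calc _ ≤ 28 * (n * s) + l * (66 * (n * s)) := by gcongr
      _ ≤ 100 * (n * s) + l * (100 * (n * s)) := by gcongr <;> norm_num
      _ = _ := by ring
  · have h := hτ (finSumFinEquiv (.inl i))
    rw [sum_taylorTerm_reindex] at h
    simpa [roundX, roundSigns] using h
  · have h := hτ (finSumFinEquiv (.inr i))
    rw [sum_taylorTerm_reindex] at h
    simpa [roundY, roundSigns, add_comm n] using h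
end

theorem theorem2 :
    -- one program for all inputs, and constants that depend on `K` only
    ∃ P : RAMProg, ∀ K : ℝ, 0 < K → ∃ c C : ℝ, 0 < c ∧ 0 < C ∧
      ∀ (n s : ℕ) (A : Matrix (Fin n) (Fin n) ℝ)
        (H : Matrix (Fin n ⊕ Fin n) (Fin n ⊕ Fin n) ℝ) (ε η : ℝ),
        1 ≤ n → 1 ≤ s → 0 < ε → 0 < η → η ≤ ε →
        H.IsSymm → IsOffDiagSparse s H →
        ‖H‖ ≤ K * Real.log (2 * n) / η →
        IsApproxSDPSolution (bipartiteMatrix A) (ε ^ 4) (gibbsState H) →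
        ∀ l : ℕ, l = ⌈c * Real.log (2 * n) / η⌉₊ →
          -- running time and output of the rounding procedure
          (∀ ω : ℕ → ℝ, ∃ (t : ℕ) (τ : RAMState),
            RAMExec (hamiltonianOracle H) ω P (RAMState.init n l) t τ ∧
            (t : ℝ) ≤ C * n * s * (1 + Real.log (2 * n) / η) ∧
            (∀ i : Fin n, τ.mem 0 i = roundX H l ω i) ∧
            (∀ i : Fin n, τ.mem 0 (n + i) = roundY H l ω i)) ∧
          (∀ ω : ℕ → ℝ, IsSignVector (roundX H l ω) ∧ IsSignVector (roundY H l ω)) ∧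
          -- guarantees for the expected value
          Integrable (fun ω => roundX H l ω ⬝ᵥ (A *ᵥ roundY H l ω)) gaussianSequence ∧
          roundingConst A * (inftyOneNorm A - C * (n * ‖A‖ * ε)) ≤
            ∫ ω, roundX H l ω ⬝ᵥ (A *ᵥ roundY H l ω) ∂gaussianSequence ∧
          ∫ ω, roundX H l ω ⬝ᵥ (A *ᵥ roundY H l ω) ∂gaussianSequence ≤ inftyOneNorm A ∧
          roundingConst A *
              (n * ‖A‖ * (sdpObjective (bipartiteMatrix A) (gibbsState H) - C * ε)) ≤
            ∫ ω, roundX H l ω ⬝ᵥ (A *ᵥ roundY H l ω) ∂gaussianSequence ∧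
          ∫ ω, roundX H l ω ⬝ᵥ (A *ᵥ roundY H l ω) ∂gaussianSequence ≤
            n * ‖A‖ * (sdpObjective (bipartiteMatrix A) (gibbsState H) + C * ε) := by
  -- With `q = log (2n) / η`, rounding up gives `1 + l ≤ 2 + (2 K + 4) q ≤ (2 K + 6) (1 + q)`; the
  -- factor `100` is from `exec_roundingProg`. The requirement `41 ≤ C` of the value bounds holds
  -- with room to spare.
  refine ⟨roundingProg, fun K hK => ⟨2 * K + 4, 100 * (2 * K + 6), by positivity, by positivity, ?_⟩⟩
  intro n s A H ε η hn hs1 hε hη hηε hH hs hHn hsol l hl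
  have hq : 0 ≤ Real.log (2 * n) / η := by
    have : (1 : ℝ) ≤ n := by exact_mod_cast hn
    exact div_nonneg (Real.log_nonneg (by linarith)) hη.le
  have hl1 : (2 * K + 4) * Real.log (2 * n) / η ≤ l := hl ▸ Nat.le_ceil _
  refine ⟨fun ω => ?_, isSignVector_round H l, integrable_round A H l,
    integral_round_bounds hn hε hη hηε hH hHn hsol hl1 (by linarith)⟩
  obtain ⟨t, τ, he, ht, hx, hy⟩ := exec_roundingProg H hn hs1 hs l ω
  refine ⟨t, τ, he, ?_, hx, hy⟩
  have hl2 : (l : ℝ) ≤ (2 * K + 4) * (Real.log (2 * n) / η) + 1 := by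
    rw [← mul_div_assoc, hl]
    exact (Nat.ceil_lt_add_one (by rw [mul_div_assoc]; positivity)).le
  calc (t : ℝ) ≤ 100 * (n * s * (1 + l)) := by exact_mod_cast ht
    _ ≤ 100 * (n * s * ((2 * K + 6) * (1 + Real.log (2 * n) / η))) := by
        gcongr
        nlinarith
    _ = _ := by ring
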